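/- Let $n\ge 2$ be an integer, put $$\gamma(p,n)=2+(n+1)p-(n-1)p^2,\qquad p_0(n)=\frac{n+1+\sqrt{n^2+10n-7}}{2(n-1)},$$ so that $p_0(n)$ is the positive root of $\gamma(p,n)=0$, and let $1<p<p_0(n)$ and $R>0$. Let $f\in H^1(\mathbb R^n)$ be real-valued, non-negative and not identically zero. For $\varepsilon>0$ consider the initial value problem $$u_{tt}-\Delta u=|u|^p,\qquad u(x,0)=\varepsilon f(x),\qquad u_t(x,0)=0 .\tag{1}$$ For $0<T<\infty$, a solution of (1) on $[0,T)$ is a real-valued function $u$ with $$(u,u_t)\in C\bigl([0,T),H^1(\mathbb R^n)\times L^2(\mathbb R^n)\bigr),\qquad |u|^p\in L^1_{\rm loc}(\mathbb R^n\times[0,T)),$$ $$\operatorname{supp}(u,u_t)\subset\{(x,t)\in\mathbb R^n\times[0,\infty): |x|\le t+R\},$$ which satisfies the equation in the sense of distributions on $\mathbb R^n\times(0,T)$ and has the initial values $u(\cdot,0)=\varepsilon f$ and $u_t(\cdot,0)=0$. Let the lifespan $T(\varepsilon)\in[0,\infty]$ be the supremum of all $T>0$ for which (1) has a solution on $[0,T)$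 (it is $0$ if there is none). Then there exist constants $\varepsilon_1>0$ and $C>0$, depending only on $f,n,p,R$ (in particular not on $\varepsilon$), such that $$T(\varepsilon)\le C\,\varepsilon^{-2p(p-1)/\gamma(p,n)}\qquad\text{for all } 0<\varepsilon\le\varepsilon_1 .$$ -/

import Mathlib

open MeasureTheory Set
open scoped ENNReal ContDiff

namespace SemilinearWave

noncomputable section

/-- The quadratic `γ(p,n) = 2 + (n+1) p - (n-1) p²`. -/
def gamma (p : ℝ) (n : ℕ) : ℝ := 2 + ((n : ℝ) + 1) * p - ((n : ℝ) - 1) * p ^ 2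

/-- The Strauss exponent `p₀(n)`, i.e. the positive root of `γ(p,n) = 0` (for `n ≥ 2`). -/
def straussExponent (n : ℕ) : ℝ :=
  ((n : ℝ) + 1 + Real.sqrt ((n : ℝ) ^ 2 + 10 * n - 7)) / (2 * ((n : ℝ) - 1))

/-- `ℝⁿ` with the Euclidean norm. -/
abbrev Space (n : ℕ) := EuclideanSpace ℝ (Fin n)

/-- The real Hilbert space `L²(ℝⁿ)`. -/
abbrev L2 (n : ℕ) := Lp ℝ 2 (volume : Measure (Space n))

/-- `G = (G₁, …, Gₙ)`, with components in `L²(ℝⁿ)`, is the weak gradient of `w ∈ L²(ℝⁿ)`: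
`∫ w ∂ᵢφ = - ∫ Gᵢ φ` for all `φ ∈ C_c^∞(ℝⁿ)` and all `i`. -/
def IsWeakGradient {n : ℕ} (w : L2 n) (G : Fin n → L2 n) : Prop :=
  ∀ (i : Fin n) (φ : Space n → ℝ), ContDiff ℝ ∞ φ → HasCompactSupport φ →
    ∫ x, w x * fderiv ℝ φ x (EuclideanSpace.single i 1) = -∫ x, G i x * φ x

/-- `w ∈ H¹(ℝⁿ)`. -/
def MemH1 {n : ℕ} (w : L2 n) : Prop := ∃ G : Fin n → L2 n, IsWeakGradient w G

/-- `w ∈ C([0,T), H¹(ℝⁿ))`: every `w(t)` is in `H¹(ℝⁿ)`, and `w` and its weak gradient are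
continuous in time with values in `L²(ℝⁿ)`. -/
def ContinuousH1 {n : ℕ} (w : ℝ → L2 n) (T : ℝ) : Prop :=
  ContinuousOn w (Ico 0 T) ∧
    ∃ G : ℝ → Fin n → L2 n, (∀ t ∈ Ico 0 T, IsWeakGradient (w t) (G t)) ∧
      ∀ i, ContinuousOn (fun t => G t i) (Ico 0 T)

/-- `|w|^p` is locally integrable on `ℝⁿ × [0,T)`. -/
def LocallyIntegrablePower {n : ℕ} (p : ℝ) (w : ℝ → L2 n) (T : ℝ) : Prop :=
  ∀ S ∈ Ico 0 T, ∀ K : Set (Space n), IsCompact K →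
    ∫⁻ t in Icc 0 S, ∫⁻ x in K, ‖w t x‖ₑ ^ p < ⊤

/-- `u_tt - Δu = |u|^p` in the sense of distributions on `ℝⁿ × (0,T)`:
`∫∫ u (φ_tt - Δφ) dx dt = ∫∫ |u|^p φ dx dt` for all test functions
`φ ∈ C_c^∞((0,T) × ℝⁿ)`. -/
def SolvesWeakly {n : ℕ} (p : ℝ) (u : ℝ → L2 n) (T : ℝ) : Prop :=
  ∀ φ : ℝ × Space n → ℝ, ContDiff ℝ ∞ φ → HasCompactSupport φ →
    tsupport φ ⊆ Ioo 0 T ×ˢ univ →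
    ∫ t in Ioo 0 T, ∫ x, u t x *
        (iteratedDeriv 2 (fun s => φ (s, x)) t - Laplacian.laplacian (fun y => φ (t, y)) x)
      = ∫ t in Ioo 0 T, ∫ x, |u t x| ^ p * φ (t, x)

/-- `u` is a solution on `[0,T)`, with time derivative `v = u_t`, of
`u_tt - Δu = |u|^p`, `u(·,0) = ε f`, `u_t(·,0) = ε g`, such that
`(u,u_t) ∈ C([0,T), H¹(ℝⁿ) × L²(ℝⁿ))` and `supp (u,u_t) ⊆ {(x,t) : |x| ≤ t + R}`. -/
structure IsSolution {n : ℕ} (p R : ℝ) (f g : L2 n) (ε T : ℝ) (u v : ℝ → L2 n) : Prop where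
  continuous_u : ContinuousH1 u T
  continuous_v : ContinuousOn v (Ico 0 T)
  deriv_u : ∀ t ∈ Ico 0 T, HasDerivWithinAt u (v t) (Ico 0 T) t
  initial_u : u 0 = ε • f
  initial_v : v 0 = ε • g
  locallyIntegrable : LocallyIntegrablePower p u T
  equation : SolvesWeakly p u T
  support : ∀ t ∈ Ico 0 T, ∀ᵐ x : Space n, t + R < ‖x‖ → u t x = 0 ∧ v t x = 0

/-- The lifespan `T(ε)`, in `[0,∞]`: the supremum of all `T > 0` for which the initial value
problem has a solution on `[0,T)`. -/
def lifespan {n : ℕ} (p R : ℝ) (f g : L2 n) (ε : ℝ) : ℝ≥0∞ :=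
  sSup (ENNReal.ofReal '' {T : ℝ | 0 < T ∧ ∃ u v : ℝ → L2 n, IsSolution p R f g ε T u v})

end

end SemilinearWave

/-! The equation is tested twice on [0, τ], τ < T, using a time cutoff η that is 1 on [0, τ/2] and 0
from τ on. Let q be conjugate to p and X = ∫∫ |u|^p η.

With the test function η alone the data drop out, because u_t(0) = 0 and η'(0) = 0, and X = ∫∫ u
η''. Young's inequality and the support condition give X ≤ C τ^(n+1-2q)
(`IsSolution.integral_rpow_le`).

Let φ > 0 be the radial solution of Δφ = φ. As e^(-t) φ solves the wave equation, testing with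
e^(-t) φ η leaves ε ∫ fφ, a nonnegative nonlinear term, and an error involving only η' and η'', so
only times in [τ/2, τ]. Young's inequality with a free λ gives ε ∫ fφ ≤ λ^p X / p + C λ^(-q)
τ^(1-q+(n-1)(1-q/2)) (`exists_integral_initial_le`). The last exponent rests on the sharp growth φ ≲
|x|^(-(n-1)/2) e^|x|, which concentrates e^(-t) φ near the light cone.

A suitable power λ = τ^σ makes both terms multiples of τ^(-γ/(2p(p-1))) (`exists_initial_le_rpow`).
Below the Strauss exponent γ > 0, so this bounds τ, and hence T, by a power of ε.

Two points need care. Distributional test functions vanish near t = 0, so the boundary terms are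
recovered by a limit (`integral_mul_deriv_deriv_eq`). The weights 1 and φ are not compactly
supported, which the support of u repairs (`IsSolution.exists_cutoff_weight`). -/

namespace SemilinearWave

noncomputable section

/-! ### Power series of Bessel type -/

/-- The coefficients of the entire function `besselSeries m`. -/
def besselCoeff (m k : ℕ) : ℝ := ∏ j ∈ Finset.range k, ((2 * (j : ℝ) + 2) * (2 * j + m))⁻¹

/-- The entire function with `besselSeries m (r ^ 2)` the radial solution of `Δφ = φ`
in dimension `m` with `φ 0 = 1`. -/
def besselSeries (m : ℕ) (s : ℝ) : ℝ := ∑' k, besselCoeff m k * s ^ k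

lemma besselCoeff_nonneg (m k : ℕ) : 0 ≤ besselCoeff m k :=
  Finset.prod_nonneg fun _ _ => by positivity

lemma besselCoeff_zero (m : ℕ) : besselCoeff m 0 = 1 := by simp [besselCoeff]

lemma besselCoeff_succ (m k : ℕ) :
    besselCoeff m (k + 1) = besselCoeff m k * ((2 * (k : ℝ) + 2) * (2 * k + m))⁻¹ :=
  Finset.prod_range_succ _ _

/-- Each factor is largest for m = 1, where the product is exactly 1/(2k)! and the series is that of
cosh. -/
lemma besselCoeff_le {m : ℕ} (hm : 1 ≤ m) (k : ℕ) :
    besselCoeff m k ≤ ((2 * k).factorial : ℝ)⁻¹ := by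
  induction k with
  | zero => simp [besselCoeff]
  | succ k ih =>
    have hm' : (1 : ℝ) ≤ m := by exact_mod_cast hm
    rw [besselCoeff_succ, show 2 * (k + 1) = 2 * k + 1 + 1 by ring, Nat.factorial_succ,
      Nat.factorial_succ]
    push_cast
    rw [show ((2 * (k : ℝ) + 1 + 1) * ((2 * k + 1) * (2 * k).factorial))⁻¹
      = ((2 * k).factorial : ℝ)⁻¹ * ((2 * (k : ℝ) + 2) * (2 * k + 1))⁻¹ by
        rw [← mul_inv]; congr 1; ring]
    gcongr

lemma besselCoeff_le_inv_factorial {m : ℕ} (hm : 1 ≤ m) (k : ℕ) :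
    besselCoeff m k ≤ (k.factorial : ℝ)⁻¹ := by
  refine (besselCoeff_le hm k).trans ?_
  have := Nat.factorial_le (show k ≤ 2 * k by omega)
  gcongr

/-- The contiguity relation in the parameter. -/
lemma besselCoeff_add_two {m : ℕ} (hm : 1 ≤ m) (k : ℕ) :
    besselCoeff (m + 2) k * (2 * k + m) = m * besselCoeff m k := by
  have hm' : (1 : ℝ) ≤ m := by exact_mod_cast hm
  induction k with
  | zero => simp [besselCoeff]
  | succ k ih =>
    rw [besselCoeff_succ, besselCoeff_succ, ← mul_assoc, ← ih]
    push_cast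
    have h1 : (2 * (k : ℝ) + m) ≠ 0 := by positivity
    have h2 : (2 * (k : ℝ) + (m + 2)) ≠ 0 := by positivity
    have h3 : (2 * (k : ℝ) + 2) ≠ 0 := by positivity
    field_simp
    ring

/-- Coefficient form of the rule that d/ds raises the parameter by 2, up to the factor 1/(2m). -/
lemma succ_mul_besselCoeff_succ {m : ℕ} (hm : 1 ≤ m) (k : ℕ) :
    ((k : ℝ) + 1) * besselCoeff m (k + 1) = besselCoeff (m + 2) k / (2 * m) := by
  have hm' : (1 : ℝ) ≤ m := by exact_mod_cast hm
  have h := besselCoeff_add_two hm k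
  rw [besselCoeff_succ]
  have h1 : (2 * (k : ℝ) + m) ≠ 0 := by positivity
  have h3 : (2 * (k : ℝ) + 2) ≠ 0 := by positivity
  have h4 : (k : ℝ) + 1 ≠ 0 := by positivity
  have h5 : (m : ℝ) ≠ 0 := by positivity
  field_simp
  linear_combination (-1 : ℝ) * h

lemma summable_besselCoeff {m : ℕ} (hm : 1 ≤ m) (s : ℝ) :
    Summable fun k => besselCoeff m k * s ^ k := by
  refine Summable.of_norm_bounded (Real.summable_pow_div_factorial |s|) fun k => ?_
  rw [norm_mul, norm_pow, Real.norm_eq_abs, Real.norm_eq_abs, abs_of_nonneg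
    (besselCoeff_nonneg _ _), div_eq_inv_mul]
  gcongr
  exact besselCoeff_le_inv_factorial hm k

lemma hasDerivAt_besselSeries {m : ℕ} (hm : 1 ≤ m) (s : ℝ) :
    HasDerivAt (besselSeries m) (besselSeries (m + 2) s / (2 * m)) s := by
  have hm' : (1 : ℝ) ≤ m := by exact_mod_cast hm
  set M := |s| + 1
  have hM : 0 ≤ M := by positivity
  have hu : Summable fun k : ℕ => (k : ℝ) * besselCoeff m k * M ^ (k - 1) := by
    rw [← summable_nat_add_iff 1]
    refine ((summable_besselCoeff (m := m + 2) (by omega) M).div_const (2 * (m : ℝ))).congr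
      fun k => ?_
    rw [Nat.cast_add, Nat.cast_one, succ_mul_besselCoeff_succ hm, Nat.add_sub_cancel]
    ring
  have key := hasDerivAt_tsum_of_isPreconnected (𝕜 := ℝ) (t := Metric.ball (0 : ℝ) M)
    (g := fun k y => besselCoeff m k * y ^ k)
    (g' := fun k y => besselCoeff m k * (k * y ^ (k - 1))) (y₀ := 0) (y := s) hu
    Metric.isOpen_ball (convex_ball _ _).isPreconnected
    (fun k y _ => (hasDerivAt_pow k y).const_mul _)
    (fun k y hy => by
      have hy' : |y| ≤ M := by
        simpa using (mem_ball_zero_iff.1 hy).le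
      rw [norm_mul, norm_mul, norm_pow, Real.norm_eq_abs, Real.norm_eq_abs, Real.norm_eq_abs,
        abs_of_nonneg (besselCoeff_nonneg _ _), Nat.abs_cast, ← mul_assoc, mul_comm (k : ℝ)]
      have := besselCoeff_nonneg m k
      gcongr)
    (Metric.mem_ball_self (by positivity)) (summable_besselCoeff hm 0)
    (by rw [mem_ball_zero_iff]; simp [M])
  convert! key using 1
  have hs : Summable fun k : ℕ => besselCoeff m k * (k * s ^ (k - 1)) := by
    rw [← summable_nat_add_iff 1]
    refine ((summable_besselCoeff (m := m + 2) (by omega) s).div_const (2 * (m : ℝ))).congr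
      fun k => ?_
    rw [mul_div_right_comm, ← succ_mul_besselCoeff_succ hm, Nat.add_sub_cancel]
    push_cast
    ring
  rw [hs.tsum_eq_zero_add, besselSeries, ← tsum_div_const]
  simp only [Nat.cast_zero, zero_mul, mul_zero, zero_add]
  refine tsum_congr fun k => ?_
  rw [mul_div_right_comm, ← succ_mul_besselCoeff_succ hm, Nat.add_sub_cancel]
  push_cast
  ring

/-- The derivative stays in the family with parameter m + 2, so the induction runs over all m at
once. -/
lemma contDiff_besselSeries {m : ℕ} (hm : 1 ≤ m) : ContDiff ℝ ∞ (besselSeries m) := by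
  rw [contDiff_infty]
  intro N
  induction N generalizing m with
  | zero =>
    exact contDiff_zero.2 (continuous_iff_continuousAt.2 fun s =>
      (hasDerivAt_besselSeries hm s).continuousAt)
  | succ N ih =>
    rw [Nat.cast_add, Nat.cast_one, contDiff_succ_iff_deriv]
    refine ⟨fun s => (hasDerivAt_besselSeries hm s).differentiableAt, by simp, ?_⟩
    rw [funext fun s => (hasDerivAt_besselSeries hm s).deriv]
    exact (ih (by omega)).div_const _

/-- The modified Bessel equation. -/
lemma besselSeries_ode {m : ℕ} (hm : 1 ≤ m) (s : ℝ) :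
    4 * s * (besselSeries (m + 4) s / (2 * (m + 2)) / (2 * m))
      + 2 * m * (besselSeries (m + 2) s / (2 * m)) = besselSeries m s := by
  have hm' : (1 : ℝ) ≤ m := by exact_mod_cast hm
  have h0 : (m : ℝ) ≠ 0 := by positivity
  have h2 : (m : ℝ) + 2 ≠ 0 := by positivity
  -- The equation at the coefficient of s^(k+1); the constant terms are both 1 and are split off
  -- below.
  have e : ∀ k, besselCoeff (m + 4) k * s ^ k * (s / ((m + 2) * m))
      + besselCoeff (m + 2) (k + 1) * s ^ (k + 1) = besselCoeff m (k + 1) * s ^ (k + 1) := by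
    intro k
    have e1 := succ_mul_besselCoeff_succ (m := m + 2) (by omega) k
    have e2 := besselCoeff_add_two hm (k + 1)
    push_cast at e1 e2
    rw [show m + 2 + 2 = m + 4 by ring, eq_div_iff (by positivity)] at e1
    rw [pow_succ]
    field_simp
    linear_combination (-(s * s ^ k)) * e1 + (s * s ^ k * (m + 2)) * e2
  have s4 := (summable_besselCoeff (m := m + 4) (by omega) s).mul_right (s / ((m + 2) * m))
  have s2 := (summable_nat_add_iff 1).2 (summable_besselCoeff (m := m + 2) (by omega) s)
  have t := (s4.tsum_add s2).symm.trans (tsum_congr e)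
  rw [tsum_mul_right] at t
  have z2 := (summable_besselCoeff (m := m + 2) (by omega) s).tsum_eq_zero_add
  have z0 := (summable_besselCoeff hm s).tsum_eq_zero_add
  simp only [besselCoeff_zero, pow_zero, mul_one] at z0 z2
  unfold besselSeries
  rw [z0, z2, ← t]
  field_simp
  ring

lemma one_le_besselSeries {m : ℕ} (hm : 1 ≤ m) {s : ℝ} (hs : 0 ≤ s) : 1 ≤ besselSeries m s := by
  have := (summable_besselCoeff hm s).le_tsum 0 fun k _ =>
    mul_nonneg (besselCoeff_nonneg m k) (pow_nonneg hs k)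
  rwa [besselCoeff_zero, pow_zero, mul_one] at this

/-! ### The radial eigenfunction of the Laplacian -/

section Radial

variable {n : ℕ}

/-- The Laplacian of `x ↦ h (‖x‖²)`. -/
lemma laplacian_comp_norm_sq {h h' h'' : ℝ → ℝ} (h1 : ∀ s, HasDerivAt h (h' s) s)
    (h2 : ∀ s, HasDerivAt h' (h'' s) s) (x : Space n) :
    Laplacian.laplacian (fun y : Space n => h (‖y‖ ^ 2)) x
      = 4 * ‖x‖ ^ 2 * h'' (‖x‖ ^ 2) + 2 * n * h' (‖x‖ ^ 2) := by
  obtain ⟨L, hL⟩ : ∃ L : Space n →L[ℝ] Space n →L[ℝ] ℝ, ∀ y, L y = innerSL ℝ y :=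
    ⟨innerSL ℝ, fun _ => rfl⟩
  have hsq : ∀ y : Space n, HasFDerivAt (fun y : Space n => ‖y‖ ^ 2) (2 • L y) y :=
    fun y => hL y ▸ (hasStrictFDerivAt_norm_sq y).hasFDerivAt
  have d1 : ∀ y : Space n, HasFDerivAt (fun y : Space n => h (‖y‖ ^ 2))
      ((2 * h' (‖y‖ ^ 2)) • L y) y := by
    intro y
    refine ((h1 _).comp_hasFDerivAt y (hsq y)).congr_fderiv ?_
    ext v
    simp
    ring
  have d1' : fderiv ℝ (fun y : Space n => h (‖y‖ ^ 2))
      = fun y => (2 * h' (‖y‖ ^ 2)) • L y := funext fun y => (d1 y).fderiv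
  have d2 : HasFDerivAt (fun y : Space n => (2 * h' (‖y‖ ^ 2)) • L y)
      ((2 * h' (‖x‖ ^ 2)) • L
        + ((2 * h'' (‖x‖ ^ 2)) • (2 • L x)).smulRight
        (L x)) x := by
    have c : HasFDerivAt (fun y : Space n => 2 * h' (‖y‖ ^ 2))
        ((2 * h'' (‖x‖ ^ 2)) • (2 • L x)) x := by
      have := ((h2 _).comp_hasFDerivAt x (hsq x)).const_mul 2
      refine this.congr_fderiv ?_
      ext v
      simp
      ring
    exact c.smul L.hasFDerivAt
  rw [InnerProductSpace.laplacian_eq_iteratedFDeriv_orthonormalBasis _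
    (EuclideanSpace.basisFun (Fin n) ℝ)]
  simp only [iteratedFDeriv_two_apply, d1', d2.fderiv]
  simp only [Matrix.cons_val_zero, Matrix.cons_val_one, add_apply,
    smul_apply, ContinuousLinearMap.smulRight_apply, hL, innerSL_apply_apply,
    smul_eq_mul, EuclideanSpace.basisFun_apply]
  rw [EuclideanSpace.norm_sq_eq]
  simp only [Finset.sum_add_distrib]
  simp only [EuclideanSpace.inner_single_right, one_mul, conj_trivial]
  rw [add_comm, Finset.mul_sum, Finset.sum_mul]
  congr 1
  · exact Finset.sum_congr rfl fun i _ => by simp; ring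
  · simp
    ring

/-- The radial solution of `Δφ = φ` on `ℝⁿ` with `φ 0 = 1`. -/
def radialEigenfunction (n : ℕ) (x : Space n) : ℝ := besselSeries n (‖x‖ ^ 2)

lemma contDiff_radialEigenfunction (hn : 1 ≤ n) : ContDiff ℝ ∞ (radialEigenfunction n) :=
  (contDiff_besselSeries hn).comp (contDiff_norm_sq ℝ)

lemma laplacian_radialEigenfunction (hn : 1 ≤ n) (x : Space n) :
    Laplacian.laplacian (radialEigenfunction n) x = radialEigenfunction n x := by
  have h2 : ∀ s, HasDerivAt (fun s => besselSeries (n + 2) s / (2 * n))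
      (besselSeries (n + 4) s / (2 * (n + 2)) / (2 * n)) s := fun s => by
    have := (hasDerivAt_besselSeries (m := n + 2) (by omega) s).div_const (2 * (n : ℝ))
    push_cast at this
    exact this
  exact (laplacian_comp_norm_sq (hasDerivAt_besselSeries hn) h2 x).trans
    (besselSeries_ode hn _)

lemma one_le_radialEigenfunction (hn : 1 ≤ n) (x : Space n) : 1 ≤ radialEigenfunction n x :=
  one_le_besselSeries hn (by positivity)

end Radial

/-! ### Growth -/

lemma summable_and_tsum_pow_div_factorial_le {r : ℝ} (hr : 0 ≤ r) (m : ℕ) :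
    Summable (fun k : ℕ => r ^ (2 * k + m) / (2 * k + m).factorial) ∧
      ∑' k : ℕ, r ^ (2 * k + m) / (2 * k + m).factorial ≤ Real.exp r := by
  have hs := Real.summable_pow_div_factorial r
  have hi : Function.Injective fun k : ℕ => 2 * k + m := fun a b h => by
    simp only at h; omega
  refine ⟨hs.comp_injective hi, ?_⟩
  rw [Real.exp_eq_exp_ℝ, NormedSpace.exp_eq_tsum_div]
  exact tsum_comp_le_tsum_of_inj hs (fun k => by positivity) hi

/-- Termwise domination by cosh r ≤ e^r; this crude bound serves near the origin. -/
lemma besselSeries_sq_le_exp {m : ℕ} (hm : 1 ≤ m) {r : ℝ} (hr : 0 ≤ r) :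
    besselSeries m (r ^ 2) ≤ Real.exp r := by
  obtain ⟨h1, h2⟩ := summable_and_tsum_pow_div_factorial_le hr 0
  refine le_trans ((summable_besselCoeff hm _).tsum_le_tsum (fun k => ?_) h1) h2
  rw [← pow_mul, add_zero, div_eq_inv_mul]
  have := besselCoeff_le hm k
  gcongr

/-- The coefficients relative to those of `cosh`. -/
lemma sq_besselCoeff_mul_le {m : ℕ} (hm : 1 ≤ m) (k : ℕ) :
    (besselCoeff m k * (2 * k).factorial) ^ 2 * (2 * k + (m - 1)).factorial
      ≤ (m - 1).factorial * (2 * k).factorial := by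
  induction k with
  | zero => simp [besselCoeff]
  | succ k ih =>
    obtain ⟨d, rfl⟩ : ∃ d, m = d + 1 := ⟨m - 1, by omega⟩
    simp only [Nat.add_sub_cancel] at ih ⊢
    rw [besselCoeff_succ, show 2 * (k + 1) + d = 2 * k + d + 1 + 1 by ring,
      show 2 * (k + 1) = 2 * k + 1 + 1 by ring, Nat.factorial_succ, Nat.factorial_succ,
      Nat.factorial_succ, Nat.factorial_succ]
    push_cast
    set A := besselCoeff (d + 1) k
    set Q : ℝ := ((2 * k).factorial : ℝ)
    set P : ℝ := ((2 * k + d).factorial : ℝ)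
    have e : (A * ((2 * (k : ℝ) + 2) * (2 * k + (d + 1)))⁻¹ *
        ((2 * k + 1 + 1) * ((2 * k + 1) * Q))) ^ 2 * ((2 * k + d + 1 + 1) * ((2 * k + d + 1) * P))
        = ((A * Q) ^ 2 * P) * ((2 * k + 1) ^ 2 * (2 * k + d + 2) / (2 * k + d + 1)) := by
      have h1 : (2 * (k : ℝ) + 2) ≠ 0 := by positivity
      have h2 : (2 * (k : ℝ) + (d + 1)) ≠ 0 := by positivity
      have h3 : (2 * (k : ℝ) + d + 1) ≠ 0 := by positivity
      rw [show (2 * (k : ℝ) + (d + 1)) = 2 * k + d + 1 by ring]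
      field_simp
      ring
    rw [e]
    calc _ ≤ ((d.factorial : ℝ) * Q) * ((2 * k + 1) ^ 2 * (2 * k + d + 2) / (2 * k + d + 1)) := by
          gcongr
      _ ≤ ((d.factorial : ℝ) * Q) * ((2 * k + 2) * (2 * k + 1)) := by
          gcongr
          -- After cancelling 2k+1, this is (2k+1)(2k+d+2) ≤ (2k+2)(2k+d+1), where the sides differ
          -- by exactly d.
          rw [div_le_iff₀ (by positivity)]
          have hk : (0 : ℝ) ≤ k := by positivity
          have hd : (0 : ℝ) ≤ d := by positivity
          nlinarith [mul_nonneg hk hd, mul_nonneg (mul_nonneg hk hd) hk, mul_nonneg hk hk]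
      _ = _ := by ring

/-- The sharp rate r^(-(m-1)/2) e^r, by Cauchy–Schwarz. Write the series as ∑ c_k w_k with w_k the
terms of cosh r; then (∑ c_k w_k)² ≤ ∑ w_k · ∑ c_k² w_k. The first factor is at most e^r. By
`sq_besselCoeff_mul_le` the second, times r^(m-1), is at most (m-1)! times a subseries of e^r. -/
lemma besselSeries_sq_le {m : ℕ} (hm : 1 ≤ m) {r : ℝ} (hr : 0 ≤ r) :
    besselSeries m (r ^ 2) ^ 2 * r ^ (m - 1) ≤ (m - 1).factorial * Real.exp (2 * r) := by
  obtain ⟨h1, h2⟩ := summable_and_tsum_pow_div_factorial_le hr 0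
  obtain ⟨h3, h4⟩ := summable_and_tsum_pow_div_factorial_le hr (m - 1)
  set c : ℕ → ℝ := fun k => besselCoeff m k * (2 * k).factorial
  set w : ℕ → ℝ := fun k => r ^ (2 * k) / (2 * k).factorial
  have hw : ∀ k, 0 ≤ w k := fun k => by positivity
  have hcw : ∀ k, besselCoeff m k * (r ^ 2) ^ k = c k * w k := fun k => by
    simp only [c, w]
    have : ((2 * k).factorial : ℝ) ≠ 0 := by positivity
    rw [← pow_mul]
    field_simp
  have hc2 : ∀ k, c k ^ 2 * w k * r ^ (m - 1)
      ≤ (m - 1).factorial * (r ^ (2 * k + (m - 1)) / (2 * k + (m - 1)).factorial) := fun k => by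
    have := sq_besselCoeff_mul_le hm k
    have f1 : (0 : ℝ) < (2 * k).factorial := by positivity
    have f2 : (0 : ℝ) < (2 * k + (m - 1)).factorial := by positivity
    have h : c k ^ 2 / (2 * k).factorial ≤ (m - 1).factorial / (2 * k + (m - 1)).factorial := by
      rw [div_le_div_iff₀ f1 f2]
      exact this
    calc c k ^ 2 * w k * r ^ (m - 1) = c k ^ 2 / (2 * k).factorial * r ^ (2 * k + (m - 1)) := by
          simp only [w]; rw [pow_add]; ring
      _ ≤ (m - 1).factorial / (2 * k + (m - 1)).factorial * r ^ (2 * k + (m - 1)) := by gcongr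
      _ = _ := by ring
  have hfin : ∀ s : Finset ℕ, (∑ k ∈ s, c k * w k) ^ 2 * r ^ (m - 1)
      ≤ (m - 1).factorial * Real.exp (2 * r) := by
    intro s
    have cs : (∑ k ∈ s, c k * w k) ^ 2 ≤ (∑ k ∈ s, w k) * ∑ k ∈ s, c k ^ 2 * w k :=
      Finset.sum_sq_le_sum_mul_sum_of_sq_le_mul s (fun k _ => hw k)
        (fun k _ => mul_nonneg (sq_nonneg _) (hw k)) fun k _ => le_of_eq (by ring)
    calc _ ≤ ((∑ k ∈ s, w k) * ∑ k ∈ s, c k ^ 2 * w k) * r ^ (m - 1) := by gcongr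
      _ = (∑ k ∈ s, w k) * ∑ k ∈ s, c k ^ 2 * w k * r ^ (m - 1) := by
          rw [mul_assoc, ← Finset.sum_mul]
      _ ≤ Real.exp r * ((m - 1).factorial * Real.exp r) := by
          have a1 : ∑ k ∈ s, w k ≤ Real.exp r :=
            (h1.sum_le_tsum s fun k _ => by positivity).trans h2
          have a2 : ∑ k ∈ s, c k ^ 2 * w k * r ^ (m - 1) ≤ (m - 1).factorial * Real.exp r := by
            refine (Finset.sum_le_sum fun k _ => hc2 k).trans ?_
            rw [← Finset.mul_sum]
            gcongr
            exact (h3.sum_le_tsum s fun k _ => by positivity).trans h4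
          have a3 : 0 ≤ ∑ k ∈ s, c k ^ 2 * w k * r ^ (m - 1) :=
            Finset.sum_nonneg fun k _ => by have := hw k; positivity
          gcongr
      _ = _ := by rw [two_mul, Real.exp_add]; ring
  have hsum := (summable_besselCoeff hm (r ^ 2)).hasSum
  rw [show (fun k => besselCoeff m k * (r ^ 2) ^ k) = fun k => c k * w k from funext hcw,
    ← show besselSeries m (r ^ 2) = ∑' k, c k * w k from tsum_congr hcw, HasSum,
    SummationFilter.unconditional_filter] at hsum
  have : Filter.Tendsto (fun s : Finset ℕ => (∑ k ∈ s, c k * w k) ^ 2 * r ^ (m - 1))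
      Filter.atTop (nhds (besselSeries m (r ^ 2) ^ 2 * r ^ (m - 1))) :=
    (Filter.Tendsto.pow hsum 2).mul_const _
  exact le_of_tendsto' this hfin

/-! ### Concentration near the light cone -/

section

variable {n : ℕ}

/-- The sharp rate for ‖x‖ ≥ 1 and the crude bound for ‖x‖ ≤ 1, joined into one estimate without
degeneration at the origin. -/
lemma radialEigenfunction_sq_mul_le (hn : 1 ≤ n) (x : Space n) :
    radialEigenfunction n x ^ 2 * (1 + ‖x‖) ^ (n - 1)
      ≤ 2 ^ (n - 1) * (n - 1).factorial * Real.exp (2 * ‖x‖) := by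
  have hr := norm_nonneg x
  rcases le_total ‖x‖ 1 with h | h
  · have h1 : radialEigenfunction n x ^ 2 ≤ Real.exp (2 * ‖x‖) := by
      rw [two_mul, Real.exp_add, ← sq]
      have := besselSeries_sq_le_exp hn hr
      have h0 := one_le_radialEigenfunction hn x
      unfold radialEigenfunction at h0 ⊢
      gcongr
    have h2 : (1 + ‖x‖) ^ (n - 1) ≤ 2 ^ (n - 1) := by gcongr; linarith
    have h3 : (1 : ℝ) ≤ (n - 1).factorial := by exact_mod_cast Nat.factorial_pos _
    calc _ ≤ Real.exp (2 * ‖x‖) * 2 ^ (n - 1) := by gcongr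
      _ = 2 ^ (n - 1) * 1 * Real.exp (2 * ‖x‖) := by ring
      _ ≤ _ := by gcongr
  · have h2 : (1 + ‖x‖) ^ (n - 1) ≤ 2 ^ (n - 1) * ‖x‖ ^ (n - 1) := by
      rw [← mul_pow]; gcongr; linarith
    have h3 := besselSeries_sq_le hn hr
    calc _ ≤ radialEigenfunction n x ^ 2 * (2 ^ (n - 1) * ‖x‖ ^ (n - 1)) := by gcongr
      _ = 2 ^ (n - 1) * (besselSeries n (‖x‖ ^ 2) ^ 2 * ‖x‖ ^ (n - 1)) := by
        unfold radialEigenfunction; ring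
      _ ≤ 2 ^ (n - 1) * ((n - 1).factorial * Real.exp (2 * ‖x‖)) := by gcongr
      _ = _ := by ring

/-- Inside the light cone, `e^{-t} φ` is concentrated near the boundary. -/
lemma exists_exp_mul_radialEigenfunction_sq_le (hn : 1 ≤ n) (R : ℝ) :
    ∃ K : ℝ, 0 < K ∧ ∀ t : ℝ, 0 ≤ t → ∀ x : Space n, ‖x‖ ≤ t + R →
      (radialEigenfunction n x * Real.exp (-t)) ^ 2 * (1 + t) ^ (n - 1)
        ≤ K * Real.exp (‖x‖ - t) := by
  set K₀ : ℝ := 2 ^ (n - 1) * (n - 1).factorial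
  have hK₀ : 0 < K₀ := by positivity
  set d := n - 1
  refine ⟨K₀ * (d.factorial * Real.exp 1 + Real.exp R), by positivity, fun t ht x hx => ?_⟩
  have hr := norm_nonneg x
  have h1 := radialEigenfunction_sq_mul_le hn x
  have hpos : 0 < (1 + ‖x‖) ^ d := by positivity
  -- Half of the decay e^(2(‖x‖-t)) pays for replacing 1+‖x‖ by 1+t: inside the cone 1+t ≤
  -- (1+‖x‖)(1+(t-‖x‖)), and the exponential absorbs the power of the last factor. In the remaining
  -- strip t ≤ ‖x‖ ≤ t+R, the spare exponential is at most e^R.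
  have h2 : (1 + t) ^ d * Real.exp (2 * (‖x‖ - t))
      ≤ (1 + ‖x‖) ^ d * ((d.factorial * Real.exp 1 + Real.exp R) * Real.exp (‖x‖ - t)) := by
    rcases le_total ‖x‖ t with h | h
    · have a1 : (1 + t) ^ d ≤ (1 + ‖x‖) ^ d * (1 + (t - ‖x‖)) ^ d := by
        rw [← mul_pow]
        gcongr
        nlinarith
      have a2 : (1 + (t - ‖x‖)) ^ d ≤ d.factorial * Real.exp (1 + (t - ‖x‖)) := by
        have := Real.pow_div_factorial_le_exp (1 + (t - ‖x‖)) (by linarith) d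
        rw [div_le_iff₀ (by positivity)] at this
        linarith
      calc _ ≤ ((1 + ‖x‖) ^ d * (d.factorial * Real.exp (1 + (t - ‖x‖))))
              * Real.exp (2 * (‖x‖ - t)) := by
            gcongr
            exact a1.trans (by gcongr)
        _ = (1 + ‖x‖) ^ d * ((d.factorial * Real.exp 1) * Real.exp (‖x‖ - t)) := by
            have : Real.exp (1 + (t - ‖x‖)) * Real.exp (2 * (‖x‖ - t))
              = Real.exp 1 * Real.exp (‖x‖ - t) := by
              rw [← Real.exp_add, ← Real.exp_add]; congr 1; ring
            linear_combination ((1 + ‖x‖) ^ d * d.factorial) * this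
        _ ≤ _ := by
            gcongr
            linarith [Real.exp_pos R]
    · have a1 : (1 + t) ^ d ≤ (1 + ‖x‖) ^ d := by gcongr
      have a2 : Real.exp (2 * (‖x‖ - t))
          ≤ (d.factorial * Real.exp 1 + Real.exp R) * Real.exp (‖x‖ - t) := by
        rw [two_mul, Real.exp_add]
        gcongr
        have : Real.exp (‖x‖ - t) ≤ Real.exp R := Real.exp_le_exp.2 (by linarith)
        have : (0 : ℝ) ≤ d.factorial * Real.exp 1 := by positivity
        linarith
      gcongr
  have h3 : (radialEigenfunction n x * Real.exp (-t)) ^ 2 * (1 + t) ^ d * (1 + ‖x‖) ^ d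
      ≤ K₀ * ((1 + t) ^ d * Real.exp (2 * (‖x‖ - t))) := by
    calc _ = radialEigenfunction n x ^ 2 * (1 + ‖x‖) ^ d * (Real.exp (-t) ^ 2 * (1 + t) ^ d) := by
          ring
      _ ≤ (K₀ * Real.exp (2 * ‖x‖)) * (Real.exp (-t) ^ 2 * (1 + t) ^ d) := by gcongr
      _ = _ := by
          have : Real.exp (2 * ‖x‖) * Real.exp (-t) ^ 2 = Real.exp (2 * (‖x‖ - t)) := by
            rw [sq, ← Real.exp_add, ← Real.exp_add]; congr 1; ring
          linear_combination (K₀ * (1 + t) ^ d) * this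
  refine le_of_mul_le_mul_right (h3.trans ?_) hpos
  calc _ ≤ K₀ * ((1 + ‖x‖) ^ d *
        ((d.factorial * Real.exp 1 + Real.exp R) * Real.exp (‖x‖ - t))) := by gcongr
    _ = _ := by ring

/-- In polar coordinates the mass sits in a shell of bounded width near ‖x‖ = t, of area of order
(1+t)^(n-1). -/
lemma integral_closedBall_exp_le (hn : 1 ≤ n) {c R : ℝ} (hc : 0 < c) (hR : 0 ≤ R) :
    ∃ C : ℝ, 0 < C ∧ ∀ t : ℝ, 0 ≤ t →
      ∫ x in Metric.closedBall (0 : Space n) (t + R), Real.exp (c * (‖x‖ - t))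
        ≤ C * (1 + t) ^ (n - 1) := by
  have : Nonempty (Fin n) := ⟨⟨0, hn⟩⟩
  set V : ℝ := (volume : Measure (Space n)).real (Metric.ball 0 1)
  refine ⟨(n * V + 1) * ((1 + R) ^ (n - 1) * (Real.exp (c * R) / c)), by positivity,
    fun t ht => ?_⟩
  have hb : 0 ≤ t + R := by positivity
  have e1 : ∫ x in Metric.closedBall (0 : Space n) (t + R), Real.exp (c * (‖x‖ - t))
      = ∫ x : Space n, (Iic (t + R)).indicator (fun r => Real.exp (c * (r - t))) ‖x‖ := by
    rw [← integral_indicator Metric.isClosed_closedBall.measurableSet]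
    congr 1
    ext x
    simp [indicator]
  have e2 : ∫ y in Ioi (0 : ℝ), y ^ (n - 1) •
        (Iic (t + R)).indicator (fun r => Real.exp (c * (r - t))) y
      = ∫ y in (0 : ℝ)..(t + R), y ^ (n - 1) * Real.exp (c * (y - t)) := by
    rw [intervalIntegral.integral_of_le hb, ← Ioi_inter_Iic,
      ← setIntegral_indicator measurableSet_Iic]
    congr 1
    ext y
    simp [indicator]
  have hcont : Continuous fun y : ℝ => Real.exp (c * (y - t)) := by fun_prop
  have e3 : ∫ y in (0 : ℝ)..(t + R), y ^ (n - 1) * Real.exp (c * (y - t))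
      ≤ ∫ y in (0 : ℝ)..(t + R), (t + R) ^ (n - 1) * Real.exp (c * (y - t)) := by
    refine intervalIntegral.integral_mono_on hb
      (Continuous.intervalIntegrable (by fun_prop) _ _)
      (Continuous.intervalIntegrable (by fun_prop) _ _) fun y hy => ?_
    have := hy.1
    have := hy.2
    gcongr
  have e4 : ∫ y in (0 : ℝ)..(t + R), Real.exp (c * (y - t)) ≤ Real.exp (c * R) / c := by
    rw [intervalIntegral.integral_eq_sub_of_hasDerivAt (f := fun y => Real.exp (c * (y - t)) / c)
      (fun y _ => by
        have := (((hasDerivAt_id y).sub_const t).const_mul c).exp.div_const c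
        refine this.congr_deriv ?_
        field_simp
        simp) (hcont.intervalIntegrable _ _)]
    have : 0 ≤ Real.exp (c * (0 - t)) / c := by positivity
    rw [show t + R - t = R by ring]
    linarith
  rw [e1, integral_fun_norm_addHaar volume, finrank_euclideanSpace, Fintype.card_fin, e2,
    nsmul_eq_mul, smul_eq_mul, ← mul_assoc]
  rw [intervalIntegral.integral_const_mul] at e3
  have hV : 0 ≤ V := measureReal_nonneg
  have hab : (t + R) ^ (n - 1) ≤ (1 + R) ^ (n - 1) * (1 + t) ^ (n - 1) := by
    rw [← mul_pow]
    gcongr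
    nlinarith
  have e5 : 0 ≤ ∫ y in (0 : ℝ)..(t + R), Real.exp (c * (y - t)) :=
    intervalIntegral.integral_nonneg hb fun y _ => (Real.exp_pos _).le
  calc _ ≤ (n * V) * (((1 + R) ^ (n - 1) * (1 + t) ^ (n - 1)) * (Real.exp (c * R) / c)) := by
        gcongr
        refine e3.trans ?_
        gcongr
    _ ≤ (n * V + 1) * (((1 + R) ^ (n - 1) * (1 + t) ^ (n - 1)) * (Real.exp (c * R) / c)) := by
        gcongr
        linarith
    _ = _ := by ring

/-- The pointwise cone bound to the power q/2 contributes (1+t)^(-(n-1)q/2), and the shell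
contributes (1+t)^(n-1). -/
lemma exists_integral_exp_mul_radialEigenfunction_rpow_le (hn : 1 ≤ n) {q R : ℝ} (hq : 0 < q)
    (hR : 0 ≤ R) :
    ∃ C : ℝ, 0 < C ∧ ∀ t : ℝ, 0 ≤ t →
      ∫ x in Metric.closedBall (0 : Space n) (t + R),
          (radialEigenfunction n x * Real.exp (-t)) ^ q
        ≤ C * (1 + t) ^ (((n : ℝ) - 1) * (1 - q / 2)) := by
  obtain ⟨K, hK, hKb⟩ := exists_exp_mul_radialEigenfunction_sq_le hn R
  obtain ⟨C, hC, hCb⟩ := integral_closedBall_exp_le (n := n) hn (half_pos hq) hR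
  refine ⟨K ^ (q / 2) * C, by positivity, fun t ht => ?_⟩
  have ht1 : 0 < 1 + t := by positivity
  have hnn : ((n - 1 : ℕ) : ℝ) = (n : ℝ) - 1 := by rw [Nat.cast_sub hn, Nat.cast_one]
  have hpt : ∀ x ∈ Metric.closedBall (0 : Space n) (t + R),
      (radialEigenfunction n x * Real.exp (-t)) ^ q
        ≤ K ^ (q / 2) * (1 + t) ^ (-(((n : ℝ) - 1) * (q / 2)))
          * Real.exp (q / 2 * (‖x‖ - t)) := by
    intro x hx
    have h0 : 0 ≤ radialEigenfunction n x * Real.exp (-t) := by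
      have := one_le_radialEigenfunction hn x
      positivity
    have h1 := hKb t ht x (mem_closedBall_zero_iff.1 hx)
    have h2 : (radialEigenfunction n x * Real.exp (-t)) ^ 2
        ≤ K * Real.exp (‖x‖ - t) * (1 + t) ^ (-((n : ℝ) - 1)) := by
      rw [Real.rpow_neg ht1.le, ← hnn, Real.rpow_natCast, ← div_eq_mul_inv,
        le_div_iff₀ (by positivity)]
      exact h1
    calc _ = ((radialEigenfunction n x * Real.exp (-t)) ^ 2) ^ (q / 2) := by
          rw [← Real.rpow_natCast, ← Real.rpow_mul h0]; congr 1; push_cast; ring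
      _ ≤ (K * Real.exp (‖x‖ - t) * (1 + t) ^ (-((n : ℝ) - 1))) ^ (q / 2) := by gcongr
      _ = _ := by
          rw [Real.mul_rpow (by positivity) (by positivity), Real.mul_rpow hK.le (by positivity),
            ← Real.exp_mul, ← Real.rpow_mul ht1.le, mul_comm (‖x‖ - t), neg_mul]
          ring
  have hcφ : Continuous (radialEigenfunction n) := (contDiff_radialEigenfunction hn).continuous
  have hint := setIntegral_mono_on (μ := volume)
    (((hcφ.mul continuous_const).rpow_const fun x => Or.inr hq.le).continuousOn.integrableOn_compact
      (isCompact_closedBall (0 : Space n) (t + R)))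
    (ContinuousOn.integrableOn_compact
      (isCompact_closedBall (0 : Space n) (t + R)) (by fun_prop))
    Metric.isClosed_closedBall.measurableSet hpt
  refine hint.trans ?_
  rw [integral_const_mul]
  calc _ ≤ K ^ (q / 2) * (1 + t) ^ (-(((n : ℝ) - 1) * (q / 2))) * (C * (1 + t) ^ (n - 1)) := by
        gcongr
        exact hCb t ht
    _ = K ^ (q / 2) * C * ((1 + t) ^ (-(((n : ℝ) - 1) * (q / 2))) * (1 + t) ^ ((n : ℝ) - 1)) := by
        rw [← hnn, Real.rpow_natCast]; ring
    _ = _ := by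
        rw [← Real.rpow_add ht1]
        congr 2
        ring

end

/-! ### Boundary terms at t = 0 -/

/-- A smooth function vanishing on `(-∞, 1]` and equal to `1` on `[2, ∞)`. -/
def switch (s : ℝ) : ℝ := Real.smoothTransition (s - 1)

lemma contDiff_switch : ContDiff ℝ ∞ switch :=
  Real.smoothTransition.contDiff.comp (contDiff_id.sub contDiff_const)

lemma switch_of_le {s : ℝ} (hs : s ≤ 1) : switch s = 0 :=
  Real.smoothTransition.zero_of_nonpos (by linarith)

lemma switch_of_ge {s : ℝ} (hs : 2 ≤ s) : switch s = 1 :=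
  Real.smoothTransition.one_of_one_le (by linarith)

lemma abs_switch_le (s : ℝ) : |switch s| ≤ 1 :=
  (abs_of_nonneg (Real.smoothTransition.nonneg (s - 1))).le.trans
    (Real.smoothTransition.le_one _)

lemma contDiff_deriv {θ : ℝ → ℝ} (hθ : ContDiff ℝ ∞ θ) : ContDiff ℝ ∞ (deriv θ) :=
  (contDiff_infty_iff_deriv.1 hθ).2

lemma hasDerivAt_of_contDiff {θ : ℝ → ℝ} (hθ : ContDiff ℝ ∞ θ) (t : ℝ) :
    HasDerivAt θ (deriv θ t) t :=
  ((contDiff_infty_iff_deriv.1 hθ).1 t).hasDerivAt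

lemma deriv_eq_zero_of_forall_ge {θ : ℝ → ℝ} (hθ : ContDiff ℝ ∞ θ) {τ c : ℝ}
    (h0 : ∀ t, τ ≤ t → θ t = c) {t : ℝ} (ht : τ ≤ t) : deriv θ t = 0 := by
  have hd := (hasDerivAt_of_contDiff hθ t).hasDerivWithinAt (s := Ici t)
  have hc : HasDerivWithinAt θ 0 (Ici t) t :=
    (hasDerivWithinAt_const t (Ici t) c).congr (fun s hs => h0 s (ht.trans hs)) (h0 t ht)
  exact (uniqueDiffWithinAt_Ici t).eq_deriv _ hd hc

lemma deriv_eq_zero_of_forall_le {θ : ℝ → ℝ} (hθ : ContDiff ℝ ∞ θ) {τ c : ℝ}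
    (h0 : ∀ t, t ≤ τ → θ t = c) {t : ℝ} (ht : t ≤ τ) : deriv θ t = 0 := by
  have hd := (hasDerivAt_of_contDiff hθ t).hasDerivWithinAt (s := Iic t)
  have hc : HasDerivWithinAt θ 0 (Iic t) t :=
    (hasDerivWithinAt_const t (Iic t) c).congr (fun s hs => h0 s (le_trans hs ht)) (h0 t ht)
  exact (uniqueDiffWithinAt_Iic t).eq_deriv _ hd hc

lemma tendsto_integral_mul_switch {τ : ℝ} (hτ : 0 ≤ τ) {g : ℝ → ℝ}
    (hg : IntervalIntegrable g volume 0 τ) :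
    Filter.Tendsto (fun k : ℕ => ∫ t in (0 : ℝ)..τ, g t * switch (k * t)) Filter.atTop
      (nhds (∫ t in (0 : ℝ)..τ, g t)) := by
  refine intervalIntegral.tendsto_integral_filter_of_dominated_convergence (fun t => ‖g t‖)
    (Filter.Eventually.of_forall fun k => ?_) (Filter.Eventually.of_forall fun k => ?_) hg.norm ?_
  · exact hg.def'.aestronglyMeasurable.mul
      (contDiff_switch.continuous.comp (by fun_prop)).aestronglyMeasurable
  · refine Filter.Eventually.of_forall fun t _ => ?_
    rw [norm_mul]
    exact mul_le_of_le_one_right (norm_nonneg _) (abs_switch_le _)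
  · refine Filter.Eventually.of_forall fun t ht => ?_
    rw [uIoc_of_le hτ] at ht
    refine tendsto_const_nhds.congr' ?_
    obtain ⟨N, hN⟩ := exists_nat_ge (2 / t)
    filter_upwards [Filter.eventually_ge_atTop N] with k hk
    have : (2 : ℝ) ≤ k * t := by
      rw [← div_le_iff₀ ht.1]
      exact hN.trans (by exact_mod_cast hk)
    rw [switch_of_ge this, mul_one]

/-- The kernels k · switch'(kt) have mass 1 and live on [1/k, 2/k], so they tend to the delta at 0+.
The proof substitutes s = kt. -/
lemma tendsto_integral_mul_deriv_switch {τ : ℝ} (hτ : 0 < τ) {g : ℝ → ℝ} (hg : Continuous g) :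
    Filter.Tendsto (fun k : ℕ => ∫ t in (0 : ℝ)..τ, g t * (k * deriv switch (k * t))) Filter.atTop
      (nhds (g 0)) := by
  have hβ : Continuous (deriv switch) := (contDiff_deriv contDiff_switch).continuous
  have h2 : Filter.Tendsto (fun k : ℕ => ∫ s in (0 : ℝ)..2, g ((k : ℝ)⁻¹ * s) * deriv switch s)
      Filter.atTop (nhds (∫ s in (0 : ℝ)..2, g 0 * deriv switch s)) := by
    obtain ⟨M, hM⟩ := (isCompact_Icc (a := (0 : ℝ)) (b := 2)).exists_bound_of_continuousOn
      hg.continuousOn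
    refine intervalIntegral.tendsto_integral_filter_of_dominated_convergence
      (fun s => M * ‖deriv switch s‖)
      (Filter.Eventually.of_forall fun k => ?_) ?_
      (Continuous.intervalIntegrable (by fun_prop) _ _) ?_
    · exact ((hg.comp (continuous_const.mul continuous_id)).mul hβ).aestronglyMeasurable
    · filter_upwards [Filter.eventually_ge_atTop 1] with k hk
      refine Filter.Eventually.of_forall fun s hs => ?_
      rw [uIoc_of_le (by norm_num)] at hs
      rw [norm_mul]
      refine mul_le_mul_of_nonneg_right (hM _ ⟨by have := hs.1; positivity, ?_⟩) (norm_nonneg _)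
      have hk' : (k : ℝ)⁻¹ ≤ 1 := inv_le_one_of_one_le₀ (by exact_mod_cast hk)
      nlinarith [hs.1, hs.2]
    · refine Filter.Eventually.of_forall fun s _ => Filter.Tendsto.mul_const _ ?_
      have : Filter.Tendsto (fun k : ℕ => (k : ℝ)⁻¹ * s) Filter.atTop (nhds (0 * s)) :=
        tendsto_inv_atTop_nhds_zero_nat.mul_const s
      rw [zero_mul] at this
      exact (hg.tendsto 0).comp this
  have h3 : ∫ s in (0 : ℝ)..2, g 0 * deriv switch s = g 0 := by
    rw [intervalIntegral.integral_const_mul, intervalIntegral.integral_eq_sub_of_hasDerivAt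
      (fun s _ => hasDerivAt_of_contDiff contDiff_switch s) (hβ.intervalIntegrable _ _),
      switch_of_ge le_rfl, switch_of_le zero_le_one]
    ring
  rw [h3] at h2
  refine h2.congr' ?_
  obtain ⟨N, hN⟩ := exists_nat_ge (2 / τ)
  filter_upwards [Filter.eventually_ge_atTop N, Filter.eventually_ge_atTop 1] with k hk hk1
  have hk2 : (2 : ℝ) ≤ k * τ := by
    rw [← div_le_iff₀ hτ]
    exact hN.trans (by exact_mod_cast hk)
  have hk0 : (k : ℝ) ≠ 0 := by positivity
  have hc : Continuous fun s => g ((k : ℝ)⁻¹ * s) * deriv switch s := by fun_prop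
  obtain ⟨G, hG⟩ : ∃ G : ℝ → ℝ, ∀ s, g ((k : ℝ)⁻¹ * s) * deriv switch s = G s :=
    ⟨_, fun _ => rfl⟩
  have e : ∀ t : ℝ, g t * (k * deriv switch (k * t)) = k * G (k * t) := fun t => by
    rw [← hG, inv_mul_cancel_left₀ hk0]
    ring
  simp_rw [e]
  simp_rw [hG] at hc ⊢
  rw [intervalIntegral.integral_const_mul, intervalIntegral.integral_comp_mul_left _ hk0,
    smul_eq_mul, mul_inv_cancel_left₀ hk0, mul_zero,
    ← intervalIntegral.integral_add_adjacent_intervals (hc.intervalIntegrable 0 2)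
      (hc.intervalIntegrable 2 (k * τ))]
  have : ∫ s in (2 : ℝ)..(k * τ), G s
      = ∫ s in (2 : ℝ)..(k * τ), (0 : ℝ) := by
    refine intervalIntegral.integral_congr fun s hs => ?_
    rw [uIcc_of_le hk2] at hs
    rw [← hG, deriv_eq_zero_of_forall_ge contDiff_switch (fun t ht => switch_of_ge ht) hs.1, mul_zero]
  rw [this]
  simp

/-- If `F'' = K` in the sense of distributions on `(0, T)` and `F` is `C¹` up to `t = 0`, then
test functions need not vanish near `t = 0`, at the price of boundary terms. -/
lemma integral_mul_deriv_deriv_eq {T τ : ℝ} (hτ : 0 < τ) (hτT : τ < T) {F W K : ℝ → ℝ}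
    (hF : ∀ t ∈ Ico 0 T, HasDerivWithinAt F (W t) (Ico 0 T) t) (hW : ContinuousOn W (Ico 0 T))
    (hK : IntervalIntegrable K volume 0 τ)
    (h : ∀ θ : ℝ → ℝ, ContDiff ℝ ∞ θ → HasCompactSupport θ → tsupport θ ⊆ Ioo 0 T →
      ∫ t in Ioo 0 T, F t * iteratedDeriv 2 θ t = ∫ t in Ioo 0 T, K t * θ t)
    {θ : ℝ → ℝ} (hθ : ContDiff ℝ ∞ θ) (h0 : ∀ t, τ ≤ t → θ t = 0) :
    ∫ t in (0 : ℝ)..τ, F t * deriv (deriv θ) t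
      = (∫ t in (0 : ℝ)..τ, K t * θ t) + W 0 * θ 0 - F 0 * deriv θ 0 := by
  have hsub : Icc 0 τ ⊆ Ico 0 T := fun t ht => ⟨ht.1, ht.2.trans_lt hτT⟩
  have hWτ : ContinuousOn W (Icc 0 τ) := hW.mono hsub
  have hWi : IntervalIntegrable W volume 0 τ :=
    ContinuousOn.intervalIntegrable (by rwa [uIcc_of_le hτ.le])
  have restrict : ∀ A B : ℝ → ℝ, (∀ t, τ ≤ t → B t = 0) →
      ∫ t in Ioo 0 T, A t * B t = ∫ t in (0 : ℝ)..τ, A t * B t := fun A B hB => by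
    rw [intervalIntegral.integral_of_le hτ.le]
    refine (setIntegral_eq_of_subset_of_forall_sdiff_eq_zero measurableSet_Ioo
      (fun t ht => ⟨ht.1, ht.2.trans_lt hτT⟩) fun t ht => ?_)
    rw [hB t (not_lt.1 fun hlt => ht.2 ⟨ht.1.1, hlt.le⟩), mul_zero]
  have parts : ∀ ξ : ℝ → ℝ, ContDiff ℝ ∞ ξ → (∀ t, τ ≤ t → ξ t = 0) →
      ∫ t in (0 : ℝ)..τ, F t * deriv (deriv ξ) t
        = - F 0 * deriv ξ 0 - ∫ t in (0 : ℝ)..τ, W t * deriv ξ t := fun ξ hξ hξ0 => by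
    have hξ1 := contDiff_deriv hξ
    rw [intervalIntegral.integral_mul_deriv_eq_deriv_mul_of_hasDerivWithinAt (u' := W)
      (fun t ht => (hF t (hsub (by rwa [uIcc_of_le hτ.le] at ht))).mono
        (by rwa [uIcc_of_le hτ.le]))
      (fun t _ => (hasDerivAt_of_contDiff hξ1 t).hasDerivWithinAt) hWi
      ((contDiff_deriv hξ1).continuous.intervalIntegrable _ _),
      deriv_eq_zero_of_forall_ge hξ hξ0 le_rfl]
    ring
  -- θ(t) · switch(kt) is an admissible test function. Moving one derivative onto F leaves only k ·
  -- switch'(kt), which tends to a delta; the second derivative would bring in k² · switch''(kt).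
  have cut : ∀ k : ℕ, 1 ≤ k → ∫ t in (0 : ℝ)..τ, K t * θ t * switch (k * t)
      = - (∫ t in (0 : ℝ)..τ, W t * deriv θ t * switch (k * t))
        - ∫ t in (0 : ℝ)..τ, W t * θ t * (k * deriv switch (k * t)) := fun k hk => by
    have hk0 : (0 : ℝ) < k := by exact_mod_cast hk
    set ξ : ℝ → ℝ := fun t => θ t * switch (k * t)
    have hξ : ContDiff ℝ ∞ ξ := hθ.mul (contDiff_switch.comp (contDiff_const.mul contDiff_id))
    have hξ0 : ∀ t, τ ≤ t → ξ t = 0 := fun t ht => by simp [ξ, h0 t ht]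
    have hξ0' : ∀ t, t ≤ (k : ℝ)⁻¹ → ξ t = 0 := fun t ht => by
      have : (k : ℝ) * t ≤ 1 := by
        rw [mul_comm]
        exact (le_inv_mul_iff₀' hk0).1 (by simpa using ht)
      simp [ξ, switch_of_le this]
    have hξs : Function.support ξ ⊆ Icc (k : ℝ)⁻¹ τ := fun t ht =>
      ⟨le_of_not_ge fun hh => ht (hξ0' t hh), le_of_not_ge fun hh => ht (hξ0 t hh)⟩
    have hts : tsupport ξ ⊆ Icc (k : ℝ)⁻¹ τ := closure_minimal hξs isClosed_Icc
    have := h ξ hξ (HasCompactSupport.of_support_subset_isCompact isCompact_Icc hξs)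
      (hts.trans fun t ht => ⟨(inv_pos.2 hk0).trans_le ht.1, ht.2.trans_lt hτT⟩)
    have hd2 : iteratedDeriv 2 ξ = deriv (deriv ξ) := by
      rw [iteratedDeriv_succ, iteratedDeriv_one]
    rw [hd2, restrict K ξ hξ0, restrict F _ fun t ht => deriv_eq_zero_of_forall_ge
      (contDiff_deriv hξ) (fun s hs => deriv_eq_zero_of_forall_ge hξ hξ0 hs) ht,
      parts ξ hξ hξ0, deriv_eq_zero_of_forall_le hξ hξ0' (inv_nonneg.2 hk0.le)] at this
    have hdξ : ∀ t, deriv ξ t = deriv θ t * switch (k * t) + θ t * (k * deriv switch (k * t)) :=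
      fun t => by
        have h1 : HasDerivAt (fun t : ℝ => switch (k * t)) (k * deriv switch (k * t)) t := by
          have := (hasDerivAt_of_contDiff contDiff_switch (k * t)).comp t
            ((hasDerivAt_id t).const_mul (k : ℝ))
          refine this.congr_deriv ?_
          simp [mul_comm]
        exact ((hasDerivAt_of_contDiff hθ t).mul h1).deriv
    have hsw : Continuous fun t : ℝ => switch (k * t) :=
      contDiff_switch.continuous.comp (by fun_prop)
    have hsw' : Continuous fun t : ℝ => (k : ℝ) * deriv switch (k * t) :=
      continuous_const.mul ((contDiff_deriv contDiff_switch).continuous.comp (by fun_prop))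
    have i1 := (hWi.mul_continuousOn (contDiff_deriv hθ).continuous.continuousOn).mul_continuousOn
      hsw.continuousOn
    have i2 := (hWi.mul_continuousOn hθ.continuous.continuousOn).mul_continuousOn
      hsw'.continuousOn
    have split : ∫ t in (0 : ℝ)..τ, W t * deriv ξ t
        = (∫ t in (0 : ℝ)..τ, W t * deriv θ t * switch (k * t))
          + ∫ t in (0 : ℝ)..τ, W t * θ t * (k * deriv switch (k * t)) := by
      rw [← intervalIntegral.integral_add i1 i2]
      refine intervalIntegral.integral_congr fun t _ => ?_
      simp only [hdξ]
      ring
    rw [split] at this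
    have e : ∫ t in (0 : ℝ)..τ, K t * θ t * switch (k * t) = ∫ t in (0 : ℝ)..τ, K t * ξ t :=
      intervalIntegral.integral_congr fun t _ => by simp only [ξ]; ring
    rw [e, ← this]
    ring
  -- W is only known to be continuous on [0, τ]; clamping the time extends it continuously to the
  -- line.
  have hproj : Continuous fun t : ℝ => W (max 0 (min t τ)) :=
    hWτ.comp_continuous (by fun_prop) fun t =>
      ⟨le_max_left _ _, max_le hτ.le (min_le_right _ _)⟩
  have lim3 : Filter.Tendsto
      (fun k : ℕ => ∫ t in (0 : ℝ)..τ, W t * θ t * (k * deriv switch (k * t)))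
      Filter.atTop (nhds (W 0 * θ 0)) := by
    have := tendsto_integral_mul_deriv_switch hτ (hproj.mul hθ.continuous)
    simp only [Pi.mul_apply, min_eq_left hτ.le, max_self] at this
    refine this.congr fun k => intervalIntegral.integral_congr fun t ht => ?_
    rw [uIcc_of_le hτ.le] at ht
    rw [min_eq_left ht.2, max_eq_right ht.1]
  have lim1 := tendsto_integral_mul_switch hτ.le (hK.mul_continuousOn hθ.continuous.continuousOn)
  have lim2 := tendsto_integral_mul_switch hτ.le
    (hWi.mul_continuousOn (contDiff_deriv hθ).continuous.continuousOn)
  have := tendsto_nhds_unique lim1 ((lim2.neg.sub lim3).congr' (by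
    filter_upwards [Filter.eventually_ge_atTop 1] with k hk using (cut k hk).symm))
  rw [parts θ hθ h0, this]
  ring

section

variable {n : ℕ}

/-! ### Duality pairings and measurability in time -/

/-- Through this functional, pairings with χ inherit continuity and differentiability in time from
the L²-valued curves. -/
lemma exists_pairing {χ : Space n → ℝ} (hχ : Continuous χ) (hc : HasCompactSupport χ) :
    ∃ L : L2 n →L[ℝ] ℝ, ∀ w : L2 n, L w = ∫ x, w x * χ x := by
  have hm : MemLp χ 2 volume := hχ.memLp_of_hasCompactSupport hc
  refine ⟨innerSL ℝ hm.toLp, fun w => ?_⟩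
  rw [innerSL_apply_apply, L2.inner_def]
  refine integral_congr_ae ?_
  filter_upwards [hm.coeFn_toLp] with x hx
  rw [hx]
  rfl

lemma integrable_mul_of_hasCompactSupport (w : L2 n) {χ : Space n → ℝ} (hχ : Continuous χ)
    (hc : HasCompactSupport χ) : Integrable fun x => w x * χ x :=
  MemLp.integrable_mul (p := 2) (q := 2) (Lp.memLp w) (hχ.memLp_of_hasCompactSupport hc)

/-- Fatou along an almost everywhere convergent subsequence. Continuity in L² can fail for the p-th
power, but semicontinuity already gives measurability in t, although no joint measurability of u in
(t, x) is assumed. -/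
lemma lowerSemicontinuous_lintegral_rpow {p : ℝ} (hp : 0 ≤ p) {χ : Space n → ℝ}
    (hχ : Continuous χ) :
    LowerSemicontinuous fun w : L2 n => ∫⁻ x, ENNReal.ofReal (|w x| ^ p * χ x) := by
  have hcont : ∀ a : ℝ, Continuous fun s : ℝ => ENNReal.ofReal (|s| ^ p * a) := fun a =>
    ENNReal.continuous_ofReal.comp
      ((continuous_abs.rpow_const fun _ => Or.inr hp).mul continuous_const)
  rw [lowerSemicontinuous_iff_isClosed_preimage]
  intro y
  refine IsSeqClosed.isClosed fun w w₀ hw hlim => ?_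
  obtain ⟨ns, -, hns⟩ := (tendstoInMeasure_of_tendsto_Lp hlim).exists_seq_tendsto_ae
  have hmeas : ∀ k, AEMeasurable (fun x => ENNReal.ofReal (|w (ns k) x| ^ p * χ x)) volume :=
    fun k => (((Lp.aestronglyMeasurable (w (ns k))).aemeasurable.abs.pow_const p).mul
      hχ.aemeasurable).ennreal_ofReal
  have h1 : ∫⁻ x, ENNReal.ofReal (|w₀ x| ^ p * χ x)
      = ∫⁻ x, Filter.liminf (fun k => ENNReal.ofReal (|w (ns k) x| ^ p * χ x)) Filter.atTop := by
    refine lintegral_congr_ae ?_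
    filter_upwards [hns] with x hx
    exact (((hcont (χ x)).tendsto _).comp hx).liminf_eq.symm
  simp only [mem_preimage, mem_Iic]
  rw [h1]
  refine (lintegral_liminf_le' hmeas).trans ?_
  refine Filter.liminf_le_of_le (by isBoundedDefault) fun b hb => ?_
  obtain ⟨k, hk⟩ := hb.exists
  exact hk.trans (hw (ns k))

lemma aestronglyMeasurable_rpow_mul (w : L2 n) (p : ℝ) {χ : Space n → ℝ} (hχ : Continuous χ) :
    AEStronglyMeasurable (fun x => |w x| ^ p * χ x) volume :=
  (((Lp.aestronglyMeasurable w).aemeasurable.abs.pow_const p).mul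
    hχ.aemeasurable).aestronglyMeasurable

variable {u : ℝ → L2 n} {T τ p : ℝ} {χ : Space n → ℝ}

lemma lintegral_rpow_mul_lt_top (hp : 0 ≤ p) (hloc : LocallyIntegrablePower p u T)
    (hτ : 0 ≤ τ) (hτT : τ < T) (hχ : Continuous χ) (hc : HasCompactSupport χ) :
    ∫⁻ t in Icc 0 τ, ∫⁻ x, ENNReal.ofReal (|u t x| ^ p * χ x) < ⊤ := by
  obtain ⟨M, hM⟩ := hχ.bounded_above_of_compact_support hc
  have hM0 : 0 ≤ M := (norm_nonneg _).trans (hM 0)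
  have hb : ∀ t, ∫⁻ x, ENNReal.ofReal (|u t x| ^ p * χ x)
      ≤ (∫⁻ x in tsupport χ, ‖u t x‖ₑ ^ p) * ENNReal.ofReal M := by
    intro t
    rw [← lintegral_mul_const' _ _ ENNReal.ofReal_ne_top,
      ← lintegral_indicator (isClosed_tsupport χ).measurableSet]
    refine lintegral_mono fun x => ?_
    by_cases hx : x ∈ tsupport χ
    · rw [indicator_of_mem hx, ENNReal.ofReal_mul (by positivity),
        ← ENNReal.ofReal_rpow_of_nonneg (abs_nonneg _) hp, ← Real.enorm_eq_ofReal_abs]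
      gcongr
      exact (le_abs_self _).trans (hM x)
    · simp [indicator_of_notMem hx, image_eq_zero_of_notMem_tsupport hx]
  calc _ ≤ ∫⁻ t in Icc 0 τ, (∫⁻ x in tsupport χ, ‖u t x‖ₑ ^ p) * ENNReal.ofReal M :=
        lintegral_mono fun t => hb t
    _ = (∫⁻ t in Icc 0 τ, ∫⁻ x in tsupport χ, ‖u t x‖ₑ ^ p) * ENNReal.ofReal M :=
        lintegral_mul_const' _ _ ENNReal.ofReal_ne_top
    _ < ⊤ := ENNReal.mul_lt_top (hloc τ ⟨hτ, hτT⟩ _ hc) ENNReal.ofReal_lt_top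

lemma aemeasurable_lintegral_rpow_mul (hp : 0 ≤ p) (hu : ContinuousOn u (Ico 0 T))
    (hτ : 0 ≤ τ) (hτT : τ < T) (hχ : Continuous χ) :
    AEMeasurable (fun t => ∫⁻ x, ENNReal.ofReal (|u t x| ^ p * χ x))
      (volume.restrict (Icc 0 τ)) := by
  have hproj : Continuous fun t : ℝ => u (max 0 (min t τ)) :=
    hu.comp_continuous (by fun_prop) fun t =>
      ⟨le_max_left _ _, (max_le hτ (min_le_right _ _)).trans_lt hτT⟩
  have hl : LowerSemicontinuous fun t : ℝ =>
      ∫⁻ x, ENNReal.ofReal (|u (max 0 (min t τ)) x| ^ p * χ x) :=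
    (lowerSemicontinuous_lintegral_rpow hp hχ).comp hproj
  refine hl.measurable.aemeasurable.congr ?_
  filter_upwards [ae_restrict_mem measurableSet_Icc] with t ht
  rw [min_eq_left ht.2, max_eq_right ht.1]

/-- Local integrability of |u|^p is a space-time condition, so individual times may be exceptional.
-/
lemma ae_integrable_rpow_mul (hp : 0 ≤ p) (hu : ContinuousOn u (Ico 0 T))
    (hloc : LocallyIntegrablePower p u T) (hτ : 0 ≤ τ) (hτT : τ < T)
    (hχ : Continuous χ) (hc : HasCompactSupport χ) (hχ0 : ∀ x, 0 ≤ χ x) :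
    ∀ᵐ t ∂volume.restrict (Icc 0 τ), Integrable fun x => |u t x| ^ p * χ x := by
  filter_upwards [ae_lt_top' (aemeasurable_lintegral_rpow_mul hp hu hτ hτT hχ)
    (lintegral_rpow_mul_lt_top hp hloc hτ hτT hχ hc).ne] with t ht
  refine ⟨aestronglyMeasurable_rpow_mul _ _ hχ, ?_⟩
  rwa [hasFiniteIntegral_iff_ofReal (Filter.Eventually.of_forall fun x =>
    mul_nonneg (by positivity) (hχ0 x))]

lemma intervalIntegrable_integral_rpow_mul (hp : 0 ≤ p) (hu : ContinuousOn u (Ico 0 T))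
    (hloc : LocallyIntegrablePower p u T) (hτ : 0 ≤ τ) (hτT : τ < T)
    (hχ : Continuous χ) (hc : HasCompactSupport χ) (hχ0 : ∀ x, 0 ≤ χ x) :
    IntervalIntegrable (fun t => ∫ x, |u t x| ^ p * χ x) volume 0 τ := by
  rw [intervalIntegrable_iff_integrableOn_Icc_of_le hτ]
  -- At exceptional times both sides are 0: the Bochner integral by convention, and `toReal ⊤`.
  have e : (fun t => ∫ x, |u t x| ^ p * χ x)
      = fun t => (∫⁻ x, ENNReal.ofReal (|u t x| ^ p * χ x)).toReal := by
    ext t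
    exact integral_eq_lintegral_of_nonneg_ae (Filter.Eventually.of_forall fun x =>
      mul_nonneg (by positivity) (hχ0 x)) (aestronglyMeasurable_rpow_mul _ _ hχ)
  rw [e]
  exact integrable_toReal_of_lintegral_ne_top (aemeasurable_lintegral_rpow_mul hp hu hτ hτT hχ)
    (lintegral_rpow_mul_lt_top hp hloc hτ hτT hχ hc).ne

/-! ### Separable test functions -/

lemma laplacian_const_mul {χ : Space n → ℝ} (hχ : ContDiff ℝ ∞ χ) (a : ℝ) (x : Space n) :
    Laplacian.laplacian (fun y => a * χ y) x = a * Laplacian.laplacian χ x :=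
  InnerProductSpace.laplacian_smul a (contDiff_infty.1 hχ 2).contDiffAt

lemma laplacian_eq_sum {χ : Space n → ℝ} : Laplacian.laplacian χ = fun x =>
    ∑ i, iteratedFDeriv ℝ 2 χ x ![EuclideanSpace.basisFun (Fin n) ℝ i,
      EuclideanSpace.basisFun (Fin n) ℝ i] :=
  InnerProductSpace.laplacian_eq_iteratedFDeriv_orthonormalBasis _ _

lemma continuous_laplacian {χ : Space n → ℝ} (hχ : ContDiff ℝ ∞ χ) :
    Continuous (Laplacian.laplacian χ) := by
  rw [laplacian_eq_sum]
  have := (contDiff_infty.1 hχ 2).continuous_iteratedFDeriv (m := 2) le_rfl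
  exact continuous_finsetSum _ fun i _ =>
    (ContinuousMultilinearMap.apply ℝ (fun _ : Fin 2 => Space n) ℝ _).continuous.comp this

lemma hasCompactSupport_laplacian {χ : Space n → ℝ} (hc : HasCompactSupport χ) :
    HasCompactSupport (Laplacian.laplacian χ) := by
  refine (hc.iteratedFDeriv (𝕜 := ℝ) 2).mono fun x hx => ?_
  rw [Function.mem_support] at hx ⊢
  contrapose! hx
  simp [laplacian_eq_sum, hx]

/-- The weak equation for products of a function of time and a function of space. -/
lemma SolvesWeakly.integral_separable (h : SolvesWeakly p u T) (hT : 0 < T) (hp : 0 ≤ p)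
    (hu : ContinuousOn u (Ico 0 T)) (hloc : LocallyIntegrablePower p u T)
    (hχ : ContDiff ℝ ∞ χ) (hc : HasCompactSupport χ) (hχ0 : ∀ x, 0 ≤ χ x)
    {θ : ℝ → ℝ} (hθ : ContDiff ℝ ∞ θ) (hθc : HasCompactSupport θ) (hθT : tsupport θ ⊆ Ioo 0 T) :
    ∫ t in Ioo 0 T, (∫ x, u t x * χ x) * iteratedDeriv 2 θ t
      = ∫ t in Ioo 0 T, ((∫ x, u t x * Laplacian.laplacian χ x) + ∫ x, |u t x| ^ p * χ x) * θ t := by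
  have hΔ := continuous_laplacian hχ
  have hΔc := hasCompactSupport_laplacian hc
  -- With b the last time in the support of θ, everything happens on the compact interval [0, b] in
  -- [0, T), where local integrability applies.
  obtain ⟨b, hb0, hbT, hb⟩ : ∃ b, 0 ≤ b ∧ b < T ∧ ∀ t, b < t → t ∉ tsupport θ := by
    rcases (tsupport θ).eq_empty_or_nonempty with he | hne
    · exact ⟨0, le_rfl, hT, by simp [he]⟩
    · obtain ⟨b, hb, hmax⟩ := hθc.isCompact.exists_isGreatest hne
      exact ⟨b, (hθT hb).1.le, (hθT hb).2, fun t ht hm => absurd (hmax hm) (not_le.2 ht)⟩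
  have hint : ∀ A B : ℝ → ℝ, IntervalIntegrable A volume 0 b → Continuous B →
      (∀ t, t ∉ tsupport θ → B t = 0) → IntegrableOn (fun t => A t * B t) (Ioo 0 T) := by
    intro A B hA hB hB0
    have := hA.mul_continuousOn hB.continuousOn
    rw [intervalIntegrable_iff_integrableOn_Icc_of_le hb0] at this
    refine this.of_forall_sdiff_eq_zero measurableSet_Ioo fun t ht => ?_
    rw [hB0 t (hb t (not_le.1 fun hle => ht.2 ⟨ht.1.1.le, hle⟩)), mul_zero]
  have hpair : ∀ ξ : Space n → ℝ, Continuous ξ → HasCompactSupport ξ →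
      IntervalIntegrable (fun t => ∫ x, u t x * ξ x) volume 0 b := by
    intro ξ hξ hξc
    obtain ⟨L, hL⟩ := exists_pairing hξ hξc
    simp_rw [← hL]
    refine ContinuousOn.intervalIntegrable ?_
    rw [uIcc_of_le hb0]
    exact L.continuous.comp_continuousOn
      (hu.mono fun t ht => ⟨ht.1, ht.2.trans_lt hbT⟩)
  have hd2 : iteratedDeriv 2 θ = deriv (deriv θ) := by
    rw [iteratedDeriv_succ, iteratedDeriv_one]
  have hθ2 : Continuous (iteratedDeriv 2 θ) := by
    rw [hd2]
    exact (contDiff_deriv (contDiff_deriv hθ)).continuous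
  have hθ20 : ∀ t, t ∉ tsupport θ → iteratedDeriv 2 θ t = 0 := fun t ht => by
    rw [hd2]
    exact image_eq_zero_of_notMem_tsupport fun h' =>
      ht (tsupport_deriv_subset (tsupport_deriv_subset h'))
  have hθ00 : ∀ t, t ∉ tsupport θ → θ t = 0 := fun t ht => image_eq_zero_of_notMem_tsupport ht
  have iF := hint _ _ (hpair χ hχ.continuous hc) hθ2 hθ20
  have iG := hint _ _ (hpair _ hΔ hΔc) hθ.continuous hθ00
  have iH := hint _ _ (intervalIntegrable_integral_rpow_mul hp hu hloc hb0 hbT hχ.continuous hc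
    hχ0) hθ.continuous hθ00
  have hsupp : Function.support (fun z : ℝ × Space n => θ z.1 * χ z.2)
      ⊆ tsupport θ ×ˢ tsupport χ := fun z hz => by
    rw [Function.mem_support, mul_ne_zero_iff] at hz
    exact ⟨subset_tsupport _ hz.1, subset_tsupport _ hz.2⟩
  have key := h (fun z => θ z.1 * χ z.2)
    ((hθ.comp contDiff_fst).mul (hχ.comp contDiff_snd))
    (HasCompactSupport.of_support_subset_isCompact (hθc.isCompact.prod hc.isCompact) hsupp)
    ((closure_minimal hsupp ((isClosed_tsupport _).prod (isClosed_tsupport _))).trans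
      (prod_mono hθT (subset_univ _)))
  have e1 : ∀ t, ∫ x, u t x * (iteratedDeriv 2 (fun s => θ s * χ x) t
        - Laplacian.laplacian (fun y => θ t * χ y) x)
      = (∫ x, u t x * χ x) * iteratedDeriv 2 θ t
        - (∫ x, u t x * Laplacian.laplacian χ x) * θ t := fun t => by
    rw [← integral_mul_const, ← integral_mul_const, ← integral_sub
      ((integrable_mul_of_hasCompactSupport _ hχ.continuous hc).mul_const _)
      ((integrable_mul_of_hasCompactSupport _ hΔ hΔc).mul_const _)]
    congr 1
    ext x
    have : iteratedDeriv 2 (fun s => θ s * χ x) t = iteratedDeriv 2 θ t * χ x := by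
      rw [hd2, iteratedDeriv_succ, iteratedDeriv_one]
      simp
    rw [this, laplacian_const_mul hχ]
    ring
  have e2 : ∀ t, ∫ x, |u t x| ^ p * (θ t * χ x) = (∫ x, |u t x| ^ p * χ x) * θ t := fun t => by
    rw [← integral_mul_const]
    congr 1
    ext x
    ring
  simp only [e1, e2] at key
  rw [integral_sub iF iG] at key
  simp only [add_mul]
  rw [integral_add iG iH, ← key]
  ring

/-- The weak equation with test functions that need not vanish near `t = 0`. -/
lemma IsSolution.integral_separable {R ε : ℝ} {f g : L2 n} {v : ℝ → L2 n}
    (h : IsSolution p R f g ε T u v) (hp : 0 ≤ p) (hτ : 0 < τ) (hτT : τ < T)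
    (hχ : ContDiff ℝ ∞ χ) (hc : HasCompactSupport χ) (hχ0 : ∀ x, 0 ≤ χ x)
    {θ : ℝ → ℝ} (hθ : ContDiff ℝ ∞ θ) (h0 : ∀ t, τ ≤ t → θ t = 0) :
    ∫ t in (0 : ℝ)..τ, (∫ x, u t x * χ x) * deriv (deriv θ) t
      = (∫ t in (0 : ℝ)..τ,
          ((∫ x, u t x * Laplacian.laplacian χ x) + ∫ x, |u t x| ^ p * χ x) * θ t)
        + (∫ x, v 0 x * χ x) * θ 0 - (∫ x, u 0 x * χ x) * deriv θ 0 := by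
  obtain ⟨L, hL⟩ := exists_pairing hχ.continuous hc
  obtain ⟨L', hL'⟩ := exists_pairing (continuous_laplacian hχ) (hasCompactSupport_laplacian hc)
  have hu := h.continuous_u.1
  refine integral_mul_deriv_deriv_eq hτ hτT (W := fun t => ∫ x, v t x * χ x)
    (K := fun t => (∫ x, u t x * Laplacian.laplacian χ x) + ∫ x, |u t x| ^ p * χ x)
    (fun t ht => ?_) ?_ (IntervalIntegrable.add ?_ ?_)
    (fun ξ hξ hξc hξT => h.equation.integral_separable (hτ.trans hτT) hp hu h.locallyIntegrable
      hχ hc hχ0 hξ hξc hξT) hθ h0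
  · simp_rw [← hL]
    exact L.hasFDerivAt.comp_hasDerivWithinAt t (h.deriv_u t ht)
  · simp_rw [← hL]
    exact L.continuous.comp_continuousOn h.continuous_v
  · simp_rw [← hL']
    refine ContinuousOn.intervalIntegrable ?_
    rw [uIcc_of_le hτ.le]
    exact L'.continuous.comp_continuousOn (hu.mono fun t ht => ⟨ht.1, ht.2.trans_lt hτT⟩)
  · exact intervalIntegrable_integral_rpow_mul hp hu h.locallyIntegrable hτ.le hτT hχ.continuous hc
      hχ0

/-! ### Weights without compact support -/

lemma exists_cutoff (r : ℝ) : ∃ b : Space n → ℝ, ContDiff ℝ ∞ b ∧ HasCompactSupport b ∧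
    (∀ x, 0 ≤ b x) ∧ ∀ x, ‖x‖ < r → b x = 1 := by
  let b : ContDiffBump (0 : Space n) := ⟨|r| + 1, |r| + 2, by positivity, by linarith⟩
  refine ⟨b, b.contDiff, b.hasCompactSupport, fun x => b.nonneg, fun x hx => ?_⟩
  refine b.one_of_mem_closedBall (mem_closedBall_zero_iff.2 ?_)
  change ‖x‖ ≤ |r| + 1
  linarith [le_abs_self r]

section Weights

variable {R ε : ℝ} {f g : L2 n} {v : ℝ → L2 n} {ψ : Space n → ℝ}

/-- A compactly supported weight which agrees with `ψ` on the support of `u` up to time `τ`. -/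
lemma IsSolution.exists_cutoff_weight (h : IsSolution p R f g ε T u v) (hτT : τ < T)
    (hψ : ContDiff ℝ ∞ ψ) (hψ0 : ∀ x, 0 ≤ ψ x) :
    ∃ χ : Space n → ℝ, ContDiff ℝ ∞ χ ∧ HasCompactSupport χ ∧ (∀ x, 0 ≤ χ x) ∧
      ∀ t ∈ Icc 0 τ, ∀ᵐ x, u t x = 0 ∨
        (χ x = ψ x ∧ Laplacian.laplacian χ x = Laplacian.laplacian ψ x) := by
  -- The extra 1 makes the cutoff equal to 1 on a neighbourhood of the support of u, so the
  -- Laplacians agree there too.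
  obtain ⟨b, hb, hbc, hb0, hb1⟩ := exists_cutoff (n := n) (τ + R + 1)
  refine ⟨fun x => ψ x * b x, hψ.mul hb, hbc.mul_left, fun x => mul_nonneg (hψ0 x) (hb0 x),
    fun t ht => ?_⟩
  filter_upwards [h.support t ⟨ht.1, ht.2.trans_lt hτT⟩] with x hx
  by_cases hxt : t + R < ‖x‖
  · exact Or.inl (hx hxt).1
  · have hxr : ‖x‖ < τ + R + 1 := by linarith [ht.2, not_lt.1 hxt]
    refine Or.inr ⟨by rw [hb1 x hxr, mul_one], Filter.EventuallyEq.eq_of_nhds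
      (InnerProductSpace.laplacian_congr_nhds ?_)⟩
    filter_upwards [continuous_norm.continuousAt.eventually_lt continuousAt_const hxr] with y hy
    rw [hb1 y hy, mul_one]

lemma IsSolution.exists_cutoff_weight_rpow (h : IsSolution p R f g ε T u v) (hp : 0 < p)
    (hτT : τ < T) (hψ : ContDiff ℝ ∞ ψ) (hψ0 : ∀ x, 0 ≤ ψ x) :
    ∃ χ : Space n → ℝ, ContDiff ℝ ∞ χ ∧ HasCompactSupport χ ∧ (∀ x, 0 ≤ χ x) ∧
      (∀ t ∈ Icc 0 τ, ∀ᵐ x, u t x = 0 ∨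
        (χ x = ψ x ∧ Laplacian.laplacian χ x = Laplacian.laplacian ψ x)) ∧
      (∀ t ∈ Icc 0 τ, (fun x => u t x * χ x) =ᵐ[volume] fun x => u t x * ψ x) ∧
      ∀ t ∈ Icc 0 τ, (fun x => |u t x| ^ p * χ x) =ᵐ[volume] fun x => |u t x| ^ p * ψ x := by
  obtain ⟨χ, h1, h2, h3, h4⟩ := h.exists_cutoff_weight hτT hψ hψ0
  refine ⟨χ, h1, h2, h3, h4, fun t ht => ?_, fun t ht => ?_⟩ <;>
  · filter_upwards [h4 t ht] with x hx
    rcases hx with hx | hx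
    · simp [hx, Real.zero_rpow hp.ne']
    · rw [hx.1]

lemma IsSolution.integrable_mul (h : IsSolution p R f g ε T u v) (hp : 0 < p)
    (hψ : ContDiff ℝ ∞ ψ) (hψ0 : ∀ x, 0 ≤ ψ x) {t : ℝ} (ht : t ∈ Ico 0 T) :
    Integrable fun x => u t x * ψ x := by
  obtain ⟨χ, h1, h2, -, -, h5, -⟩ := h.exists_cutoff_weight_rpow (τ := t) hp ht.2 hψ hψ0
  exact (integrable_mul_of_hasCompactSupport _ h1.continuous h2).congr (h5 t ⟨ht.1, le_rfl⟩)

lemma IsSolution.ae_integrable_rpow_mul (h : IsSolution p R f g ε T u v) (hp : 0 < p)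
    (hτ : 0 ≤ τ) (hτT : τ < T) (hψ : ContDiff ℝ ∞ ψ) (hψ0 : ∀ x, 0 ≤ ψ x) :
    ∀ᵐ t ∂volume.restrict (Icc 0 τ), Integrable fun x => |u t x| ^ p * ψ x := by
  obtain ⟨χ, h1, h2, h3, -, -, h6⟩ := h.exists_cutoff_weight_rpow hp hτT hψ hψ0
  filter_upwards [SemilinearWave.ae_integrable_rpow_mul hp.le h.continuous_u.1 h.locallyIntegrable
    hτ hτT h1.continuous h2 h3, ae_restrict_mem measurableSet_Icc] with t ht1 ht2
  exact ht1.congr (h6 t ht2)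

lemma IsSolution.intervalIntegrable_integral_rpow_mul (h : IsSolution p R f g ε T u v)
    (hp : 0 < p) (hτ : 0 ≤ τ) (hτT : τ < T) (hψ : ContDiff ℝ ∞ ψ) (hψ0 : ∀ x, 0 ≤ ψ x) :
    IntervalIntegrable (fun t => ∫ x, |u t x| ^ p * ψ x) volume 0 τ := by
  obtain ⟨χ, h1, h2, h3, -, -, h6⟩ := h.exists_cutoff_weight_rpow hp hτT hψ hψ0
  refine (SemilinearWave.intervalIntegrable_integral_rpow_mul hp.le h.continuous_u.1
    h.locallyIntegrable hτ hτT h1.continuous h2 h3).congr fun t ht => ?_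
  rw [uIoc_of_le hτ] at ht
  exact integral_congr_ae (h6 t ⟨ht.1.le, ht.2⟩)

lemma IsSolution.intervalIntegrable_integral_mul (h : IsSolution p R f g ε T u v)
    (hp : 0 < p) (hτ : 0 ≤ τ) (hτT : τ < T) (hψ : ContDiff ℝ ∞ ψ) (hψ0 : ∀ x, 0 ≤ ψ x) :
    IntervalIntegrable (fun t => ∫ x, u t x * ψ x) volume 0 τ := by
  obtain ⟨χ, h1, h2, -, -, h5, -⟩ := h.exists_cutoff_weight_rpow hp hτT hψ hψ0
  obtain ⟨L, hL⟩ := exists_pairing h1.continuous h2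
  have : IntervalIntegrable (fun t => ∫ x, u t x * χ x) volume 0 τ := by
    simp_rw [← hL]
    refine ContinuousOn.intervalIntegrable ?_
    rw [uIcc_of_le hτ]
    exact L.continuous.comp_continuousOn
      (h.continuous_u.1.mono fun t ht => ⟨ht.1, ht.2.trans_lt hτT⟩)
  refine this.congr fun t ht => ?_
  rw [uIoc_of_le hτ] at ht
  exact integral_congr_ae (h5 t ⟨ht.1.le, ht.2⟩)

/-- The weak equation tested with the product of an eigenfunction `ψ` of the Laplacian and a
function of time; the initial velocity is zero. -/
lemma IsSolution.integral_eigenfunction (h : IsSolution p R f 0 ε T u v) (hp : 0 < p)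
    (hτ : 0 < τ) (hτT : τ < T) (hψ : ContDiff ℝ ∞ ψ) (hψ0 : ∀ x, 0 ≤ ψ x) {c : ℝ}
    (hc : ∀ x, Laplacian.laplacian ψ x = c * ψ x)
    {θ : ℝ → ℝ} (hθ : ContDiff ℝ ∞ θ) (h0 : ∀ t, τ ≤ t → θ t = 0) :
    ∫ t in (0 : ℝ)..τ, (∫ x, u t x * ψ x) * (deriv (deriv θ) t - c * θ t)
      = (∫ t in (0 : ℝ)..τ, (∫ x, |u t x| ^ p * ψ x) * θ t)
        - (ε * ∫ x, f x * ψ x) * deriv θ 0 := by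
  obtain ⟨χ, h1, h2, h3, h4, h5, h6⟩ := h.exists_cutoff_weight_rpow hp hτT hψ hψ0
  have key := h.integral_separable hp.le hτ hτT h1 h2 h3 hθ h0
  have hmem : ∀ t ∈ uIcc 0 τ, t ∈ Icc 0 τ := fun t ht => by rwa [uIcc_of_le hτ.le] at ht
  have e1 : ∫ t in (0 : ℝ)..τ, (∫ x, u t x * χ x) * deriv (deriv θ) t
      = ∫ t in (0 : ℝ)..τ, (∫ x, u t x * ψ x) * deriv (deriv θ) t :=
    intervalIntegral.integral_congr fun t ht => by
      rw [integral_congr_ae (h5 t (hmem t ht))]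
  have e2 : ∫ t in (0 : ℝ)..τ,
        ((∫ x, u t x * Laplacian.laplacian χ x) + ∫ x, |u t x| ^ p * χ x) * θ t
      = ∫ t in (0 : ℝ)..τ, ((∫ x, u t x * ψ x) * (c * θ t) + (∫ x, |u t x| ^ p * ψ x) * θ t) :=
    intervalIntegral.integral_congr fun t ht => by
      have : ∫ x, u t x * Laplacian.laplacian χ x = (∫ x, u t x * ψ x) * c := by
        rw [← integral_mul_const]
        refine integral_congr_ae ?_
        filter_upwards [h4 t (hmem t ht)] with x hx
        rcases hx with hx | hx
        · simp [hx]
        · rw [hx.2, hc]; ring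
      rw [integral_congr_ae (h6 t (hmem t ht)), this]
      ring
  have e3 : ∫ x, v 0 x * χ x = 0 := by
    rw [h.initial_v, smul_zero]
    simp
  have e4 : ∫ x, u 0 x * χ x = ε * ∫ x, f x * ψ x := by
    rw [integral_congr_ae (h5 0 ⟨le_rfl, hτ.le⟩), h.initial_u, ← integral_const_mul]
    refine integral_congr_ae ?_
    filter_upwards [Lp.coeFn_smul ε f] with x hx
    rw [hx, Pi.smul_apply, smul_eq_mul, mul_assoc]
  have iU := h.intervalIntegrable_integral_mul hp hτ.le hτT hψ hψ0
  have iH := h.intervalIntegrable_integral_rpow_mul hp hτ.le hτT hψ hψ0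
  have cθ := hθ.continuous
  have i1 := iU.mul_continuousOn
    (contDiff_deriv (contDiff_deriv hθ)).continuous.continuousOn
  have cθ' : Continuous fun t => c * θ t := by fun_prop
  have i2 := iU.mul_continuousOn cθ'.continuousOn
  have i3 := iH.mul_continuousOn cθ.continuousOn
  rw [e1, e2, e3, e4, intervalIntegral.integral_add i2 i3] at key
  simp only [mul_sub]
  rw [intervalIntegral.integral_sub i1 i2, key]
  ring

end Weights

end

section

variable {n : ℕ}

/-! ### Cutoff functions in time -/

/-- The hypothesis `hj` is (j+2)/p ≤ j in disguise. -/
lemma pow_le_pow_add_two_rpow {z p : ℝ} (hp : 1 < p) {j : ℕ} (hj : 2 ≤ (j + 2 : ℝ) * (1 - 1 / p))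
    (hz0 : 0 ≤ z) (hz1 : z ≤ 1) : z ^ j ≤ (z ^ (j + 2)) ^ (1 / p) := by
  rw [← Real.rpow_natCast, ← Real.rpow_natCast, ← Real.rpow_mul hz0]
  push_cast
  have hp0 : 0 < p := by linarith
  refine Real.rpow_le_rpow_of_exponent_ge' hz0 hz1 (by positivity) ?_
  linarith

/-- A high power ζ^(j+2) of a smooth step ζ: two derivatives cost at most two powers, and ζ^j is at
most ψ^(1/p) for large j. This lets Young's inequality return the weight itself. -/
lemma exists_cutoff_profile {p : ℝ} (hp : 1 < p) : ∃ ψ : ℝ → ℝ, ContDiff ℝ ∞ ψ ∧ (∀ t, 0 ≤ ψ t) ∧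
    (∀ t, t ≤ 1 / 2 → ψ t = 1) ∧ (∀ t, 1 ≤ t → ψ t = 0) ∧ ∃ B : ℝ, 0 < B ∧
      ∀ t, |deriv ψ t| ≤ B * ψ t ^ (1 / p) ∧ |deriv (deriv ψ) t| ≤ B * ψ t ^ (1 / p) := by
  set ζ : ℝ → ℝ := fun s => Real.smoothTransition (2 - 2 * s)
  have hζ : ContDiff ℝ ∞ ζ :=
    Real.smoothTransition.contDiff.comp (contDiff_const.sub (contDiff_const.mul contDiff_id))
  have hζ0 : ∀ t, 0 ≤ ζ t := fun t => Real.smoothTransition.nonneg _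
  have hζ1 : ∀ t, ζ t ≤ 1 := fun t => Real.smoothTransition.le_one _
  have hζl : ∀ t, t ≤ 1 / 2 → ζ t = 1 := fun t ht =>
    Real.smoothTransition.one_of_one_le (by linarith)
  have hζr : ∀ t, 1 ≤ t → ζ t = 0 := fun t ht =>
    Real.smoothTransition.zero_of_nonpos (by linarith)
  have hζ' := contDiff_deriv hζ
  have hl1 : ∀ t, t ≤ 1 / 2 → deriv ζ t = 0 := fun t ht => deriv_eq_zero_of_forall_le hζ hζl ht
  have hr1 : ∀ t, 1 ≤ t → deriv ζ t = 0 := fun t ht => deriv_eq_zero_of_forall_ge hζ hζr ht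
  have bdd : ∀ g : ℝ → ℝ, Continuous g → (∀ t, t ≤ 1 / 2 → g t = 0) → (∀ t, 1 ≤ t → g t = 0) →
      ∃ M, 0 ≤ M ∧ ∀ t, |g t| ≤ M := fun g hg h1 h2 => by
    obtain ⟨M, hM⟩ := (isCompact_Icc (a := (1 / 2 : ℝ)) (b := 1)).exists_bound_of_continuousOn
      hg.continuousOn
    have hM0 : 0 ≤ M := (norm_nonneg _).trans (hM 1 ⟨by norm_num, le_rfl⟩)
    refine ⟨M, hM0, fun t => ?_⟩
    rcases le_total t (1 / 2) with h | h
    · simpa [h1 t h] using hM0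
    · rcases le_total 1 t with h' | h'
      · simpa [h2 t h'] using hM0
      · exact hM t ⟨h, h'⟩
  obtain ⟨M₁, hM₁, hb₁⟩ := bdd _ hζ'.continuous hl1 hr1
  obtain ⟨M₂, hM₂, hb₂⟩ := bdd _ (contDiff_deriv hζ').continuous
    (fun t ht => deriv_eq_zero_of_forall_le hζ' hl1 ht)
    (fun t ht => deriv_eq_zero_of_forall_ge hζ' hr1 ht)
  have hpp : 0 < 1 - 1 / p := by
    rw [sub_pos, div_lt_one (by linarith)]
    exact hp
  obtain ⟨j, hj⟩ := exists_nat_ge (2 / (1 - 1 / p))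
  have hj' : 2 ≤ (j + 2 : ℝ) * (1 - 1 / p) := by
    rw [← div_le_iff₀ hpp]
    linarith
  have d1 : deriv (fun t => ζ t ^ (j + 2)) = fun t => (j + 2) * (ζ t ^ (j + 1) * deriv ζ t) := by
    ext t
    rw [((hasDerivAt_of_contDiff hζ t).fun_pow (j + 2)).deriv]
    push_cast
    ring
  have d2 : ∀ t, deriv (deriv fun t => ζ t ^ (j + 2)) t
      = (j + 2) * (((j + 1) * (ζ t ^ j * deriv ζ t)) * deriv ζ t
        + ζ t ^ (j + 1) * deriv (deriv ζ) t) := by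
    intro t
    rw [d1]
    have := ((((hasDerivAt_of_contDiff hζ t).fun_pow (j + 1)).fun_mul
      (hasDerivAt_of_contDiff hζ' t)).const_mul ((j : ℝ) + 2)).deriv
    rw [this]
    push_cast
    ring
  refine ⟨fun t => ζ t ^ (j + 2), hζ.pow _, fun t => pow_nonneg (hζ0 t) _,
    fun t ht => by simp [hζl t ht], fun t ht => by simp [hζr t ht],
    (j + 2) * M₁ + (j + 2) * ((j + 1) * M₁ * M₁ + M₂) + 1, by positivity, fun t => ?_⟩
  have hz := pow_le_pow_add_two_rpow hp hj' (hζ0 t) (hζ1 t)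
  have hz0 : 0 ≤ ζ t ^ j := pow_nonneg (hζ0 t) _
  have hz1 : |ζ t ^ (j + 1)| ≤ ζ t ^ j := by
    rw [abs_of_nonneg (pow_nonneg (hζ0 t) _)]
    exact pow_le_pow_of_le_one (hζ0 t) (hζ1 t) (Nat.le_succ j)
  have a1 : |deriv (fun t => ζ t ^ (j + 2)) t| ≤ ((j + 2) * M₁) * ζ t ^ j := by
    rw [d1, abs_mul, abs_mul, abs_of_nonneg (by positivity : (0 : ℝ) ≤ j + 2)]
    calc _ ≤ ((j : ℝ) + 2) * (ζ t ^ j * M₁) := by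
          gcongr
          exact hb₁ t
      _ = _ := by ring
  have a2 : |deriv (deriv fun t => ζ t ^ (j + 2)) t|
      ≤ ((j + 2) * ((j + 1) * M₁ * M₁ + M₂)) * ζ t ^ j := by
    rw [d2, abs_mul, abs_of_nonneg (by positivity : (0 : ℝ) ≤ j + 2)]
    calc _ ≤ ((j : ℝ) + 2) * (((j + 1) * (ζ t ^ j * M₁)) * M₁ + ζ t ^ j * M₂) := by
          gcongr
          refine (abs_add_le _ _).trans ?_
          rw [abs_mul, abs_mul, abs_mul, abs_mul, abs_of_nonneg hz0,
            abs_of_nonneg (by positivity : (0 : ℝ) ≤ j + 1)]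
          have b1 := hb₁ t
          have b2 := hb₂ t
          gcongr
      _ = _ := by ring
  constructor
  · refine a1.trans (mul_le_mul ?_ hz hz0 (by positivity))
    have : 0 ≤ ((j : ℝ) + 2) * ((j + 1) * M₁ * M₁ + M₂) := by positivity
    linarith
  · refine a2.trans (mul_le_mul ?_ hz hz0 (by positivity))
    have : 0 ≤ ((j : ℝ) + 2) * M₁ := by positivity
    linarith

/-- `η` is a smooth cutoff in time at scale `τ`, with derivatives controlled by `η ^ (1 / p)`. -/
structure IsTimeCutoff (p B τ : ℝ) (η : ℝ → ℝ) : Prop where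
  contDiff : ContDiff ℝ ∞ η
  nonneg : ∀ t, 0 ≤ η t
  eq_one : ∀ t, t ≤ τ / 2 → η t = 1
  eq_zero : ∀ t, τ ≤ t → η t = 0
  abs_deriv_le : ∀ t, |deriv η t| ≤ B * τ⁻¹ * η t ^ (1 / p)
  abs_deriv_deriv_le : ∀ t, |deriv (deriv η) t| ≤ B * τ⁻¹ ^ 2 * η t ^ (1 / p)

lemma exists_isTimeCutoff {p : ℝ} (hp : 1 < p) :
    ∃ B : ℝ, 0 < B ∧ ∀ τ : ℝ, 0 < τ → ∃ η, IsTimeCutoff p B τ η := by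
  obtain ⟨ψ, h1, h2, h3, h4, B, hB, h5⟩ := exists_cutoff_profile hp
  refine ⟨B, hB, fun τ hτ => ⟨fun t => ψ (τ⁻¹ * t), ?_⟩⟩
  have d : ∀ ξ : ℝ → ℝ, ContDiff ℝ ∞ ξ → deriv (fun t => ξ (τ⁻¹ * t))
      = fun t => τ⁻¹ * deriv ξ (τ⁻¹ * t) := fun ξ hξ => by
    ext t
    have := (hasDerivAt_of_contDiff hξ (τ⁻¹ * t)).comp t ((hasDerivAt_id t).const_mul τ⁻¹)
    rw [mul_one, mul_comm] at this
    exact this.deriv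
  have d2 : deriv (deriv fun t => ψ (τ⁻¹ * t))
      = fun t => τ⁻¹ * (τ⁻¹ * deriv (deriv ψ) (τ⁻¹ * t)) := by
    rw [d ψ h1]
    ext t
    rw [deriv_const_mul_field, d _ (contDiff_deriv h1)]
  have hi : 0 < τ⁻¹ := inv_pos.2 hτ
  refine ⟨h1.comp (contDiff_const.mul contDiff_id), fun t => h2 _, fun t ht => h3 _ ?_,
    fun t ht => h4 _ ?_, fun t => ?_, fun t => ?_⟩
  · rw [inv_mul_le_iff₀ hτ]
    linarith
  · rw [le_inv_mul_iff₀ hτ]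
    linarith
  · rw [d ψ h1, abs_mul, abs_of_pos hi]
    calc _ ≤ τ⁻¹ * (B * ψ (τ⁻¹ * t) ^ (1 / p)) := by
          gcongr
          exact (h5 _).1
      _ = _ := by ring
  · rw [d2, abs_mul, abs_mul, abs_of_pos hi]
    calc _ ≤ τ⁻¹ * (τ⁻¹ * (B * ψ (τ⁻¹ * t) ^ (1 / p))) := by
          gcongr
          exact (h5 _).2
      _ = _ := by ring

namespace IsTimeCutoff

variable {p B τ : ℝ} {η : ℝ → ℝ}

lemma deriv_eq_zero (h : IsTimeCutoff p B τ η) {t : ℝ} (ht : t ≤ τ / 2) : deriv η t = 0 :=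
  deriv_eq_zero_of_forall_le h.contDiff h.eq_one ht

lemma deriv_deriv_eq_zero (h : IsTimeCutoff p B τ η) {t : ℝ} (ht : t ≤ τ / 2) :
    deriv (deriv η) t = 0 :=
  deriv_eq_zero_of_forall_le (contDiff_deriv h.contDiff) (fun _ hs => h.deriv_eq_zero hs) ht

end IsTimeCutoff

/-! ### Young's inequality in space -/

/-- Pointwise Young for λ|w| e^(1/p) and λ⁻¹ Aφ: the power 1/p turns into the weight e, and the
second term is needed only on the ball, where w lives. The parameter λ stays free for the final
balancing. -/
lemma abs_integral_mul_le {p q lam r a A e : ℝ} (hpq : p.HolderConjugate q) (hlam : 0 < lam)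
    (hA : 0 ≤ A) (he : 0 ≤ e) (ha : |a| ≤ A * e ^ (1 / p)) {w : L2 n} {φ : Space n → ℝ}
    (hφ : Continuous φ) (hφ0 : ∀ x, 0 ≤ φ x) (hw : ∀ᵐ x, r < ‖x‖ → w x = 0)
    (hi : Integrable fun x => |w x| ^ p) :
    |(∫ x, w x * φ x) * a| ≤ lam ^ p / p * ((∫ x, |w x| ^ p) * e)
      + lam ^ (-q) / q * ∫ x in Metric.closedBall 0 r, (A * φ x) ^ q := by
  have hp0 : 0 < p := hpq.pos
  have hq0 : 0 < q := hpq.symm.pos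
  have hballs : MeasurableSet (Metric.closedBall (0 : Space n) r) :=
    Metric.isClosed_closedBall.measurableSet
  have hi2 : IntegrableOn (fun x => (A * φ x) ^ q) (Metric.closedBall (0 : Space n) r) :=
    ContinuousOn.integrableOn_compact (isCompact_closedBall (0 : Space n) r)
      ((continuous_const.mul hφ).rpow_const fun _ => Or.inr hq0.le).continuousOn
  rw [← integral_mul_const, ← integral_mul_const, ← integral_const_mul,
    ← integral_const_mul, ← integral_indicator hballs, ← integral_add
      ((hi.mul_const _).const_mul _) ((integrable_indicator_iff hballs).2 (hi2.const_mul _))]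
  rw [← Real.norm_eq_abs]
  refine norm_integral_le_of_norm_le (((hi.mul_const _).const_mul _).add
    ((integrable_indicator_iff hballs).2 (hi2.const_mul _))) ?_
  filter_upwards [hw] with x hx
  rw [Real.norm_eq_abs]
  by_cases hxr : r < ‖x‖
  · rw [hx hxr, indicator_of_notMem (by simpa using hxr)]
    simp [Real.zero_rpow hp0.ne']
  · rw [indicator_of_mem (by simpa using hxr), abs_mul, abs_mul, abs_of_nonneg (hφ0 x)]
    have hy := Real.young_inequality_of_nonneg (a := lam * |w x| * e ^ (1 / p))
      (b := lam⁻¹ * (A * φ x)) (by positivity)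
      (mul_nonneg (by positivity) (mul_nonneg hA (hφ0 x))) hpq
    have hAφ : 0 ≤ A * φ x := mul_nonneg hA (hφ0 x)
    have hφx := hφ0 x
    calc |w x| * φ x * |a| ≤ |w x| * φ x * (A * e ^ (1 / p)) := by gcongr
      _ = lam * |w x| * e ^ (1 / p) * (lam⁻¹ * (A * φ x)) := by field_simp
      _ ≤ _ := hy
      _ = _ := by
        rw [Real.mul_rpow (by positivity) (by positivity),
          Real.mul_rpow (by positivity) (by positivity), ← Real.rpow_mul he,
          one_div_mul_cancel hp0.ne', Real.rpow_one, Real.mul_rpow (by positivity) hAφ,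
          Real.inv_rpow hlam.le, Real.rpow_neg hlam.le]
        ring

/-! ### The two integral estimates -/

section Estimates

variable {u v : ℝ → L2 n} {f : L2 n} {p q B R ε T τ : ℝ} {η : ℝ → ℝ}

lemma IsSolution.ae_eq_zero {g : L2 n} (h : IsSolution p R f g ε T u v) {t : ℝ}
    (ht : t ∈ Ico 0 T) : ∀ᵐ x, t + R < ‖x‖ → u t x = 0 := by
  filter_upwards [h.support t ht] with x hx hxt using (hx hxt).1

lemma IsSolution.abs_integral_mul_le {g : L2 n} (h : IsSolution p R f g ε T u v)
    (hpq : p.HolderConjugate q) (hτ : 0 ≤ τ) (hτT : τ < T) {lam : ℝ} (hlam : 0 < lam)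
    {a A : ℝ → ℝ} (hA : ∀ t, 0 ≤ A t) (hη : ∀ t, 0 ≤ η t)
    (ha : ∀ t, |a t| ≤ A t * η t ^ (1 / p)) {φ : Space n → ℝ}
    (hφ : Continuous φ) (hφ0 : ∀ x, 0 ≤ φ x) :
    ∀ᵐ t ∂volume.restrict (Icc 0 τ), |(∫ x, u t x * φ x) * a t|
      ≤ lam ^ p / p * ((∫ x, |u t x| ^ p) * η t)
        + lam ^ (-q) / q * ∫ x in Metric.closedBall 0 (t + R), (A t * φ x) ^ q := by
  have := h.ae_integrable_rpow_mul hpq.pos hτ hτT (ψ := fun _ => 1) contDiff_const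
    fun _ => zero_le_one
  filter_upwards [this, ae_restrict_mem measurableSet_Icc] with t ht1 ht2
  simp only [mul_one] at ht1
  exact SemilinearWave.abs_integral_mul_le hpq hlam (hA t) (hη t) (ha t) hφ hφ0
    (h.ae_eq_zero ⟨ht2.1, ht2.2.trans_lt hτT⟩) ht1

/-- The upper bound for the space-time integral of `|u| ^ p`. -/
lemma IsSolution.integral_rpow_le (h : IsSolution p R f 0 ε T u v) (hpq : p.HolderConjugate q)
    (hR : 0 < R) (hB : 0 < B) (hτ : 1 ≤ τ) (hτT : τ < T) (hη : IsTimeCutoff p B τ η) :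
    ∫ t in (0 : ℝ)..τ, (∫ x, |u t x| ^ p) * η t
      ≤ B ^ q * (1 + R) ^ n * (volume : Measure (Space n)).real (Metric.ball 0 1)
        * τ ^ ((n : ℝ) + 1 - 2 * q) := by
  have hp0 : 0 < p := hpq.pos
  have hq0 : 0 < q := hpq.symm.pos
  have hτ0 : 0 < τ := by linarith
  set V := (volume : Measure (Space n)).real (Metric.ball 0 1)
  have hV : 0 ≤ V := measureReal_nonneg
  have key := h.integral_eigenfunction hp0 hτ0 hτT (ψ := fun _ => 1) contDiff_const
    (fun _ => zero_le_one) (c := 0)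
    (fun x => by rw [InnerProductSpace.laplacian_const]; simp) hη.contDiff hη.eq_zero
  have i1 := h.intervalIntegrable_integral_mul hp0 hτ0.le hτT (ψ := fun _ => 1) contDiff_const
    fun _ => zero_le_one
  have i2 := h.intervalIntegrable_integral_rpow_mul hp0 hτ0.le hτT (ψ := fun _ => 1)
    contDiff_const fun _ => zero_le_one
  have hy := h.abs_integral_mul_le hpq hτ0.le hτT one_pos (a := deriv (deriv η))
    (A := fun _ => B * τ⁻¹ ^ 2) (fun _ => by positivity) hη.nonneg hη.abs_deriv_deriv_le
    (φ := fun _ => 1) continuous_const fun _ => zero_le_one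
  -- Here the data disappear: the initial velocity is zero and η is constant near 0.
  rw [hη.deriv_eq_zero (by positivity), mul_zero, sub_zero] at key
  simp only [mul_one, zero_mul, sub_zero, Real.one_rpow] at key i1 i2 hy
  set X := ∫ t in (0 : ℝ)..τ, (∫ x, |u t x| ^ p) * η t
  set D := B ^ q * (1 + R) ^ n * V * τ ^ ((n : ℝ) - 2 * q)
  have i2η := i2.mul_continuousOn hη.contDiff.continuous.continuousOn
  -- The ball contributes τ^n and the second derivative of η contributes τ^(-2q); the time integral
  -- adds one more power of τ.
  have hD : ∀ t ∈ Icc 0 τ, ∫ _x in Metric.closedBall (0 : Space n) (t + R), (B * τ⁻¹ ^ 2) ^ q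
      ≤ D := by
    intro t ht
    have htR : 0 ≤ t + R := by linarith [ht.1]
    rw [setIntegral_const, Measure.addHaar_real_closedBall _ _ htR, finrank_euclideanSpace,
      Fintype.card_fin, smul_eq_mul]
    have e : (B * τ⁻¹ ^ 2) ^ q = B ^ q * τ ^ (-(2 * q)) := by
      rw [Real.mul_rpow hB.le (by positivity), inv_pow, Real.inv_rpow (by positivity),
        ← Real.rpow_natCast, ← Real.rpow_mul hτ0.le, Real.rpow_neg hτ0.le]
      simp
    have hle : (t + R) ^ n ≤ (1 + R) ^ n * τ ^ n := by
      rw [← mul_pow]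
      gcongr
      nlinarith [ht.2]
    rw [e]
    calc _ ≤ (1 + R) ^ n * τ ^ n * V * (B ^ q * τ ^ (-(2 * q))) := by gcongr
      _ = B ^ q * (1 + R) ^ n * V * (τ ^ (n : ℝ) * τ ^ (-(2 * q))) := by
          rw [Real.rpow_natCast]; ring
      _ = D := by rw [← Real.rpow_add hτ0, ← sub_eq_add_neg]
  -- Young with λ = 1 gives X ≤ X/p + τD/q. Since 1 - 1/p = 1/q, absorbing X/p leaves X ≤ τD.
  have hX : X ≤ ∫ t in (0 : ℝ)..τ, (1 / p * ((∫ x, |u t x| ^ p) * η t) + 1 / q * D) := by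
    rw [← key]
    refine intervalIntegral.integral_mono_ae_restrict hτ0.le
      (i1.mul_continuousOn (contDiff_deriv (contDiff_deriv hη.contDiff)).continuous.continuousOn)
      ((i2η.const_mul _).add intervalIntegrable_const) ?_
    filter_upwards [hy, ae_restrict_mem measurableSet_Icc] with t ht1 ht2
    refine (le_abs_self _).trans (ht1.trans ?_)
    have := hD t ht2
    gcongr
  rw [intervalIntegral.integral_add (i2η.const_mul _) intervalIntegrable_const,
    intervalIntegral.integral_const_mul, intervalIntegral.integral_const, sub_zero,
    smul_eq_mul] at hX
  have hinv : 1 / p = 1 - 1 / q := by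
    rw [one_div, one_div]
    linarith [hpq.inv_add_inv_eq_one]
  have hXD : X ≤ τ * D := by
    rw [hinv] at hX
    have : 1 / q * X ≤ 1 / q * (τ * D) := by linarith
    exact le_of_mul_le_mul_left this (by positivity)
  refine hXD.trans_eq ?_
  rw [show (n : ℝ) + 1 - 2 * q = 1 + ((n : ℝ) - 2 * q) by ring, Real.rpow_add hτ0, Real.rpow_one]
  ring

lemma deriv_exp_neg_mul {η : ℝ → ℝ} (hη : ContDiff ℝ ∞ η) :
    deriv (fun t => Real.exp (-t) * η t) = fun t => Real.exp (-t) * (deriv η t - η t) := by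
  ext t
  have h1 : HasDerivAt (fun t : ℝ => Real.exp (-t)) (-Real.exp (-t)) t := by
    simpa using (hasDerivAt_neg t).exp
  rw [(h1.fun_mul (hasDerivAt_of_contDiff hη t)).deriv]
  ring

lemma deriv_deriv_exp_neg_mul {η : ℝ → ℝ} (hη : ContDiff ℝ ∞ η) (t : ℝ) :
    deriv (deriv fun t => Real.exp (-t) * η t) t
      = Real.exp (-t) * (deriv (deriv η) t - 2 * deriv η t + η t) := by
  rw [deriv_exp_neg_mul hη, deriv_exp_neg_mul ((contDiff_deriv hη).sub hη)]
  simp only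
  rw [deriv_fun_sub (hasDerivAt_of_contDiff (contDiff_deriv hη) t).differentiableAt
    (hasDerivAt_of_contDiff hη t).differentiableAt]
  ring

/-- Comparable bases have comparable powers. -/
lemma rpow_le_of_half_le {s τ : ℝ} (hτ : 0 < τ) (h1 : τ / 2 ≤ s) (h2 : s ≤ 2 * τ) (a : ℝ) :
    s ^ a ≤ 2 ^ |a| * τ ^ a := by
  have hs : 0 < s := by linarith
  have hx : 0 < s / τ := by positivity
  have e : s ^ a = (s / τ) ^ a * τ ^ a := by
    rw [← Real.mul_rpow hx.le hτ.le, div_mul_cancel₀ _ hτ.ne']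
  rw [e]
  gcongr
  rcases le_total 0 a with ha | ha
  · rw [abs_of_nonneg ha]
    gcongr
    rw [div_le_iff₀ hτ]
    exact h2
  · rw [abs_of_nonpos ha, ← inv_inv (s / τ), Real.inv_rpow (inv_nonneg.2 hx.le),
      ← Real.rpow_neg (inv_nonneg.2 hx.le)]
    refine Real.rpow_le_rpow (inv_nonneg.2 hx.le) ?_ (by linarith)
    rw [inv_div, div_le_iff₀ hs]
    linarith

/-- The lower bound for the space-time integral of `|u| ^ p`, in terms of the initial data. -/
lemma exists_integral_initial_le (hn : 1 ≤ n) (hpq : p.HolderConjugate q) (hR : 0 < R)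
    (hB : 0 < B) : ∃ C : ℝ, 0 < C ∧ ∀ (f : L2 n) (u v : ℝ → L2 n) (ε T τ : ℝ) (η : ℝ → ℝ),
      IsSolution p R f 0 ε T u v → 1 ≤ τ → τ < T → IsTimeCutoff p B τ η → ∀ lam : ℝ, 0 < lam →
        ε * ∫ x, f x * radialEigenfunction n x
          ≤ lam ^ p / p * (∫ t in (0 : ℝ)..τ, (∫ x, |u t x| ^ p) * η t)
            + lam ^ (-q) * C * τ ^ (1 - q + ((n : ℝ) - 1) * (1 - q / 2)) := by
  have hp0 : 0 < p := hpq.pos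
  have hq0 : 0 < q := hpq.symm.pos
  obtain ⟨C, hC, hCb⟩ := exists_integral_exp_mul_radialEigenfunction_rpow_le (n := n) hn hq0 hR.le
  set α := ((n : ℝ) - 1) * (1 - q / 2)
  refine ⟨(3 * B) ^ q * C * 2 ^ |α| / q, by positivity,
    fun f u v ε T τ η h hτ hτT hη lam hlam => ?_⟩
  set φ := radialEigenfunction n
  have hτ0 : 0 < τ := by linarith
  have hi1 : τ⁻¹ ≤ 1 := inv_le_one_of_one_le₀ hτ
  have hφc : ContDiff ℝ ∞ φ := contDiff_radialEigenfunction hn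
  have hφ0 : ∀ x, 0 ≤ φ x := fun x => zero_le_one.trans (one_le_radialEigenfunction hn x)
  have hθ : ContDiff ℝ ∞ fun t => Real.exp (-t) * η t :=
    (Real.contDiff_exp.comp contDiff_neg).mul hη.contDiff
  have key := h.integral_eigenfunction hp0 hτ0 hτT hφc hφ0 (c := 1)
    (fun x => by rw [laplacian_radialEigenfunction hn, one_mul]) hθ
    (fun t ht => by rw [hη.eq_zero t ht, mul_zero])
  -- What is left of (∂_t² - Δ)(e^(-t) φ η) once φ is factored out: every term contains a derivative
  -- of η.
  set a : ℝ → ℝ := fun t => Real.exp (-t) * (deriv (deriv η) t - 2 * deriv η t)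
  have ha : ∀ t, deriv (deriv fun t => Real.exp (-t) * η t) t - 1 * (Real.exp (-t) * η t)
      = a t := fun t => by
    rw [deriv_deriv_exp_neg_mul hη.contDiff]
    simp only [a]
    ring
  have hac : Continuous a := by
    have c1 := (contDiff_deriv hη.contDiff).continuous
    have c2 := (contDiff_deriv (contDiff_deriv hη.contDiff)).continuous
    fun_prop
  -- The slope -1 at time 0 turns the boundary term into +ε ∫ fφ.
  have hθ0 : deriv (fun t => Real.exp (-t) * η t) 0 = -1 := by
    rw [deriv_exp_neg_mul hη.contDiff]
    simp only
    rw [hη.deriv_eq_zero (by positivity), hη.eq_one 0 (by positivity)]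
    simp
  simp only [ha] at key
  rw [hθ0] at key
  -- The nonlinear term has a good sign and is discarded.
  have hpos : 0 ≤ ∫ t in (0 : ℝ)..τ, (∫ x, |u t x| ^ p * φ x) * (Real.exp (-t) * η t) := by
    refine intervalIntegral.integral_nonneg hτ0.le fun t _ => mul_nonneg
      (integral_nonneg fun x => mul_nonneg (by positivity) (hφ0 x))
      (mul_nonneg (Real.exp_pos _).le (hη.nonneg t))
  have hle : ε * ∫ x, f x * φ x ≤ ∫ t in (0 : ℝ)..τ, (∫ x, u t x * φ x) * a t := by linarith
  -- The 3 counts η'' once and η' twice, with τ⁻² ≤ τ⁻¹ because τ ≥ 1.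
  have haη : ∀ t, |a t| ≤ 3 * B * τ⁻¹ * Real.exp (-t) * η t ^ (1 / p) := by
    intro t
    have hη' : 0 ≤ η t ^ (1 / p) := Real.rpow_nonneg (hη.nonneg t) _
    have hi0 : 0 < τ⁻¹ := inv_pos.2 hτ0
    have b1 := hη.abs_deriv_le t
    have b2 : |deriv (deriv η) t| ≤ B * τ⁻¹ * η t ^ (1 / p) := by
      refine (hη.abs_deriv_deriv_le t).trans ?_
      gcongr
      nlinarith
    rw [abs_mul, abs_of_pos (Real.exp_pos _)]
    calc _ ≤ Real.exp (-t) * (B * τ⁻¹ * η t ^ (1 / p) + 2 * (B * τ⁻¹ * η t ^ (1 / p))) := by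
          gcongr
          refine (abs_sub _ _).trans ?_
          rw [abs_mul, abs_two]
          gcongr
      _ = _ := by ring
  have hy := h.abs_integral_mul_le hpq hτ0.le hτT hlam (a := a)
    (A := fun t => 3 * B * τ⁻¹ * Real.exp (-t)) (fun _ => by positivity) hη.nonneg haη
    hφc.continuous hφ0
  set D := (3 * B) ^ q * C * 2 ^ |α| * τ ^ (-q + α)
  have hball : ∀ t ∈ Icc (τ / 2) τ, ∫ x in Metric.closedBall (0 : Space n) (t + R),
      (3 * B * τ⁻¹ * Real.exp (-t) * φ x) ^ q ≤ D := by
    intro t ht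
    have ht0 : 0 ≤ t := by linarith [ht.1]
    have e : ∀ x, (3 * B * τ⁻¹ * Real.exp (-t) * φ x) ^ q
        = (3 * B) ^ q * τ ^ (-q) * (φ x * Real.exp (-t)) ^ q := fun x => by
      rw [mul_assoc _ (Real.exp (-t)), mul_comm (Real.exp (-t)),
        Real.mul_rpow (by positivity) (mul_nonneg (hφ0 x) (Real.exp_pos _).le),
        Real.mul_rpow (by positivity) (by positivity), Real.inv_rpow hτ0.le,
        Real.rpow_neg hτ0.le]
    simp_rw [e]
    rw [integral_const_mul]
    calc _ ≤ (3 * B) ^ q * τ ^ (-q) * (C * (2 ^ |α| * τ ^ α)) := by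
          gcongr
          refine (hCb t ht0).trans ?_
          gcongr
          exact rpow_le_of_half_le hτ0 (by linarith [ht.1]) (by linarith [ht.2]) _
      _ = D := by simp only [D]; rw [Real.rpow_add hτ0]; ring
  have hD0 : 0 ≤ D := by positivity
  have i1 := (h.intervalIntegrable_integral_mul hp0 hτ0.le hτT hφc hφ0).mul_continuousOn
    hac.continuousOn
  have i2 := h.intervalIntegrable_integral_rpow_mul hp0 hτ0.le hτT (ψ := fun _ => 1)
    contDiff_const fun _ => zero_le_one
  simp only [mul_one] at i2
  have i2η := i2.mul_continuousOn hη.contDiff.continuous.continuousOn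
  have hmono : ∫ t in (0 : ℝ)..τ, (∫ x, u t x * φ x) * a t
      ≤ ∫ t in (0 : ℝ)..τ, (lam ^ p / p * ((∫ x, |u t x| ^ p) * η t) + lam ^ (-q) / q * D) := by
    refine intervalIntegral.integral_mono_ae_restrict hτ0.le i1
      ((i2η.const_mul _).add intervalIntegrable_const) ?_
    filter_upwards [hy, ae_restrict_mem measurableSet_Icc] with t ht1 ht2
    -- On the first half `a` vanishes. On the second, 1+t is comparable to τ, so (1+t)^α is
    -- controlled by τ^α whatever the sign of α.
    rcases le_total t (τ / 2) with ht | ht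
    · have : a t = 0 := by
        simp only [a]
        rw [hη.deriv_eq_zero ht, hη.deriv_deriv_eq_zero ht]
        ring
      rw [this, mul_zero]
      have h1 : 0 ≤ ∫ x, |u t x| ^ p := integral_nonneg fun x => by positivity
      have h2 := hη.nonneg t
      positivity
    · refine (le_abs_self _).trans (ht1.trans ?_)
      have := hball t ⟨ht, ht2.2⟩
      gcongr
  rw [intervalIntegral.integral_add (i2η.const_mul _) intervalIntegrable_const,
    intervalIntegral.integral_const_mul, intervalIntegral.integral_const, sub_zero,
    smul_eq_mul] at hmono
  refine (hle.trans hmono).trans_eq ?_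
  congr 1
  simp only [D]
  rw [show 1 - q + α = 1 + (-q + α) by ring, Real.rpow_add hτ0 1, Real.rpow_one]
  ring

end Estimates

/-! ### The lifespan -/

/-- With s the square root, 4(n-1)γ = (n+1+s-2(n-1)p)(s-(n+1)+2(n-1)p). The first factor is positive
by p < p₀, the second because s ≥ n+1. -/
lemma gamma_pos {n : ℕ} (hn : 2 ≤ n) {p : ℝ} (hp : 1 < p) (hp0 : p < straussExponent n) :
    0 < gamma p n := by
  have hn' : (2 : ℝ) ≤ n := by exact_mod_cast hn
  unfold straussExponent at hp0
  rw [lt_div_iff₀ (by linarith)] at hp0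
  set s := Real.sqrt ((n : ℝ) ^ 2 + 10 * n - 7)
  have hs : s ^ 2 = (n : ℝ) ^ 2 + 10 * n - 7 := Real.sq_sqrt (by nlinarith)
  have hs0 : 0 ≤ s := Real.sqrt_nonneg _
  have hs1 : (n : ℝ) + 1 ≤ s := Real.le_sqrt_of_sq_le (by nlinarith)
  have h1 : 0 < (n : ℝ) + 1 + s - 2 * (n - 1) * p := by linarith
  have h2 : 0 < s - (n + 1) + 2 * (n - 1) * p := by nlinarith
  have h3 := mul_pos h1 h2
  unfold gamma
  have h4 : ((n : ℝ) + 1 + s - 2 * (n - 1) * p) * (s - (n + 1) + 2 * (n - 1) * p)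
      = 4 * (n - 1) * (2 + (n + 1) * p - (n - 1) * p ^ 2) := by
    linear_combination hs
  rw [h4] at h3
  exact pos_of_mul_pos_right h3 (by linarith)

/-- The size of the initial data is bounded by a negative power of the existence time. -/
lemma exists_initial_le_rpow (hn : 1 ≤ n) {p R : ℝ} (hp : 1 < p) (hR : 0 < R) :
    ∃ C : ℝ, 0 < C ∧ ∀ (f : L2 n) (u v : ℝ → L2 n) (ε T τ : ℝ),
      IsSolution p R f 0 ε T u v → 1 ≤ τ → τ < T →
        ε * ∫ x, f x * radialEigenfunction n x
          ≤ C * τ ^ (-(gamma p n / (2 * p * (p - 1)))) := by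
  have hpq : p.HolderConjugate (p / (p - 1)) := Real.HolderConjugate.conjExponent hp
  have hp0 : 0 < p := hpq.pos
  have hp1 : p - 1 ≠ 0 := by linarith
  set q := p / (p - 1)
  obtain ⟨B, hB, hBη⟩ := exists_isTimeCutoff hp
  obtain ⟨C₂, hC₂, hC⟩ := exists_integral_initial_le (n := n) hn hpq hR hB
  set C₁ := B ^ q * (1 + R) ^ n * (volume : Measure (Space n)).real (Metric.ball 0 1)
  have hC₁ : 0 ≤ C₁ := by positivity
  refine ⟨C₁ / p + C₂, by positivity, fun f u v ε T τ h hτ hτT => ?_⟩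
  have hτ0 : 0 < τ := by linarith
  obtain ⟨η, hη⟩ := hBη τ hτ0
  -- The solution of σp + (n+1-2q) = -σq + 1-q+(n-1)(1-q/2), which balances the two terms for λ =
  -- τ^σ. The common exponent simplifies through p + q = p²/(p-1).
  set σ := (q - 1 - ((n : ℝ) - 1) * q / 2) / (p + q)
  have h1 := h.integral_rpow_le hpq hR hB hτ hτT hη
  have h2 := hC f u v ε T τ η h hτ hτT hη (τ ^ σ) (by positivity)
  have e1 : σ * p + ((n : ℝ) + 1 - 2 * q) = -(gamma p n / (2 * p * (p - 1))) := by
    have : p + q = p ^ 2 / (p - 1) := by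
      simp only [q]
      field_simp
      ring
    simp only [σ]
    rw [this]
    simp only [q, gamma]
    field_simp
    ring
  have e2 : σ * -q + (1 - q + ((n : ℝ) - 1) * (1 - q / 2))
      = -(gamma p n / (2 * p * (p - 1))) := by
    rw [← e1]
    have : σ * (p + q) = q - 1 - ((n : ℝ) - 1) * q / 2 :=
      div_mul_cancel₀ _ (by have := hpq.symm.pos; positivity)
    linear_combination -this
  rw [← Real.rpow_mul hτ0.le, ← Real.rpow_mul hτ0.le] at h2
  calc _ ≤ τ ^ (σ * p) / p * (C₁ * τ ^ ((n : ℝ) + 1 - 2 * q))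
        + τ ^ (σ * -q) * C₂ * τ ^ (1 - q + ((n : ℝ) - 1) * (1 - q / 2)) := by
        refine h2.trans ?_
        gcongr
    _ = C₁ / p * τ ^ (σ * p + ((n : ℝ) + 1 - 2 * q))
        + C₂ * τ ^ (σ * -q + (1 - q + ((n : ℝ) - 1) * (1 - q / 2))) := by
        rw [Real.rpow_add hτ0 (σ * p) ((n : ℝ) + 1 - 2 * q),
          Real.rpow_add hτ0 (σ * -q) (1 - q + ((n : ℝ) - 1) * (1 - q / 2))]
        ring
    _ = _ := by
        rw [e1, e2]
        ring

lemma integral_mul_pos {f : L2 n} (hf : 0 ≤ f) (hf0 : f ≠ 0) {φ : Space n → ℝ}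
    (hφ : ∀ x, 0 < φ x) (hi : Integrable fun x => f x * φ x) : 0 < ∫ x, f x * φ x := by
  have hnn : 0 ≤ᵐ[volume] fun x => f x * φ x := by
    filter_upwards [(Lp.coeFn_nonneg f).2 hf] with x hx
    exact mul_nonneg hx (hφ x).le
  refine lt_of_le_of_ne (integral_nonneg_of_ae hnn) fun h0 => hf0 ?_
  rw [Lp.eq_zero_iff_ae_eq_zero]
  filter_upwards [(integral_eq_zero_iff_of_nonneg_ae hnn hi).1 h0.symm] with x hx
  exact (mul_eq_zero.1 hx).resolve_right (hφ x).ne'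

/-- A solution forces εf = u(0) to vanish almost everywhere outside ‖x‖ ≤ R, so the growth of ψ is
harmless. -/
lemma IsSolution.integrable_initial {p R ε T : ℝ} {f g : L2 n} {u v : ℝ → L2 n}
    (h : IsSolution p R f g ε T u v) (hp : 0 < p) (hT : 0 < T) (hε : ε ≠ 0) {ψ : Space n → ℝ}
    (hψ : ContDiff ℝ ∞ ψ) (hψ0 : ∀ x, 0 ≤ ψ x) : Integrable fun x => f x * ψ x := by
  have := h.integrable_mul hp hψ hψ0 (t := 0) ⟨le_rfl, hT⟩
  rw [h.initial_u] at this
  refine (this.const_mul ε⁻¹).congr ?_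
  filter_upwards [Lp.coeFn_smul ε f] with x hx
  rw [hx, Pi.smul_apply, smul_eq_mul, mul_assoc, inv_mul_cancel_left₀ hε]

/-- Solve the inequality for τ and let τ tend to T. The maximum with 1 covers T ≤ 1, where no τ is
available. -/
lemma le_of_forall_rpow_neg_le {T a b κ : ℝ} (ha : 0 < a) (hκ : 0 < κ)
    (h : ∀ τ, 1 ≤ τ → τ < T → a ≤ b * τ ^ (-κ⁻¹)) : T ≤ max 1 ((b / a) ^ κ) := by
  refine le_of_forall_lt_imp_le_of_dense fun τ hτ => ?_
  rcases le_total τ 1 with h1 | h1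
  · exact h1.trans (le_max_left _ _)
  · refine le_trans ?_ (le_max_right _ _)
    have hτ0 : 0 < τ := by linarith
    have h2 := h τ h1 hτ
    rw [Real.rpow_neg hτ0.le, ← div_eq_mul_inv, le_div_iff₀ (by positivity), mul_comm,
      ← le_div_iff₀ ha] at h2
    calc τ = (τ ^ κ⁻¹) ^ κ := by
          rw [← Real.rpow_mul hτ0.le, inv_mul_cancel₀ hκ.ne', Real.rpow_one]
      _ ≤ _ := by gcongr

end

end

end SemilinearWave

theorem theorem3p2 (n : ℕ) (hn : 2 ≤ n) (p : ℝ) (hp : 1 < p)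
    (hp0 : p < SemilinearWave.straussExponent n) (R : ℝ) (hR : 0 < R)
    (f : SemilinearWave.L2 n) (hfH1 : SemilinearWave.MemH1 f) (hf : 0 ≤ f) (hf0 : f ≠ 0) :
    ∃ ε₁ : ℝ, 0 < ε₁ ∧ ∃ C : ℝ, 0 < C ∧ ∀ ε : ℝ, 0 < ε → ε ≤ ε₁ →
      SemilinearWave.lifespan p R f 0 ε ≤
        ENNReal.ofReal (C * ε ^ (-(2 * p * (p - 1) / SemilinearWave.gamma p n))) := by
  open SemilinearWave in
  have hn1 : 1 ≤ n := by omega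
  have hγ := gamma_pos hn hp hp0
  have hφ := contDiff_radialEigenfunction hn1
  have hφ1 : ∀ x, 0 < radialEigenfunction n x := fun x =>
    zero_lt_one.trans_le (one_le_radialEigenfunction hn1 x)
  set κ := 2 * p * (p - 1) / gamma p n with hκ_def
  have hp1 : 0 < p - 1 := by linarith
  have hκ : 0 < κ := by positivity
  obtain ⟨K, hK, hKb⟩ := exists_initial_le_rpow (n := n) hn1 hp hR
  set c := ∫ x, f x * radialEigenfunction n x
  -- The constant is fixed before c > 0 is known: that needs the integrability supplied by a
  -- solution. Without solutions the supremum is over the empty set.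
  refine ⟨1, one_pos, max 1 ((K / c) ^ κ), by positivity, fun ε hε hε1 => sSup_le ?_⟩
  rintro _ ⟨T, ⟨hT, u, v, h⟩, rfl⟩
  refine ENNReal.ofReal_le_ofReal ?_
  have hc : 0 < c := integral_mul_pos hf hf0 hφ1
    (h.integrable_initial (by linarith) hT hε.ne' hφ fun x => (hφ1 x).le)
  have hT' : T ≤ max 1 ((K / (ε * c)) ^ κ) := by
    refine le_of_forall_rpow_neg_le (mul_pos hε hc) hκ fun τ h1 h2 => ?_
    rw [hκ_def, inv_div]
    exact hKb f u v ε T τ h h1 h2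
  -- This is where ε ≤ 1 enters: the alternative T ≤ 1 is absorbed into C ε^(-κ).
  have hε2 : 1 ≤ ε ^ (-κ) := Real.one_le_rpow_of_pos_of_le_one_of_nonpos hε hε1 (by linarith)
  refine hT'.trans ?_
  rw [max_mul_of_nonneg _ _ (by positivity)]
  refine max_le_max (by simpa using hε2) (le_of_eq ?_)
  rw [mul_comm ε, ← div_div, Real.div_rpow (by positivity) hε.le, Real.rpow_neg hε.le,
    div_eq_mul_inv]
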